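/- Let $R$ be a unital ring whose additive group is isomorphic to $\mathbb{Z}^d$ with $d\ge 1$. Let $R^\times=\{a\in R : ax=0\Rightarrow x=0 \text{ for all } x\in R\}$ be the multiplicative monoid of left regular elements, and let $S\subseteq R^\times$ be a submonoid with $\mathbb{Z}_{>0}\subseteq S$ which is reversible, i.e. $sS\cap tS\neq\emptyset$ and $Ss\cap St\neq\emptyset$ for all $s,t\in S$. For $s\in S$ let $\sigma_s\colon R\to R$, $x\mapsto sx$. Let $\mathscr{A}=R\otimes_{\mathbb Z}\mathbb{Q}$. Then $S\subseteq\mathscr{A}^*$, and the group of left quotients $\mathscr{S}=S^{-1}S$ is a subgroup of $\mathscr{A}^*$. For $a\in\mathscr{S}$ let $N_{\mathbb Q}(a)\in\mathbb{Q}^*$ be the determinant of the $\mathbb{Q}$-linear map $\mathscr{A}\to\mathscr{A}$, $x\mapsto ax$, and let $\bigwedge^q(a)$ be the $q$-th exterior power of this map. Let $\mathcal{C}$ be the family of subgroups of $R$ obtained from $R$ by taking finitely many images and preimages under the maps $\sigma_s$, $s\in S$. Let $\overline{R}=\varprojlim_{C\in\mathcal{C}}R/C$, with the inverse limit topology of the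 discrete groups $R/C$, on which each $\sigma_s$ acts by continuous extension. Let $\overline{\mathscr{A}}=\varinjlim_{s\in S}\{\overline{R};\sigma_s\}$, the direct limit being taken along right divisibility ($s\mid_r t$ iff $t\in Ss$) and given the direct limit topology. Then $\mathscr{A}\subseteq\overline{\mathscr{A}}$, and the action of $S$ extends to an action $\tilde\sigma$ of $\mathscr{S}$ on $\overline{\mathscr{A}}$ by automorphisms, which restricts to $x\mapsto ax$ on $\mathscr{A}$. Let $\mathbb{Z}\overline{\mathscr{A}}=C_c(\overline{\mathscr{A}},\mathbb{Z})$ be the group of compactly supported continuous $\mathbb{Z}$-valued functions, on which $\mathscr{A}$ acts by translation, and let $H_q(\mathscr{A},\mathbb{Z}\overline{\mathscr{A}})$ be group homology. For $a\in\mathscr{S}$ let $\theta_a$ be the endomorphism of $H_q(\mathscr{A},\mathbb{Z}\overline{\mathscr{A}})$ induced by the pair $(x\mapsto ax,\ f\mapsto f\circ\tilde\sigma_a^{-1})$. Then for every $q\ge 0$ there is a canonical identification $$H_q(\mathscr{A},\mathbb{Z}\overline{\mathscr{A}})\cong\begin{cases}\bigwedge^q_{\mathbb Q}\mathscr{A}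 & \text{if } q<d,\\ \bigwedge^d_{\mathbb Z}R\cong\mathbb{Z} & \text{if } q=d,\\ 0 & \text{if } q>d,\end{cases}$$ under which $$\theta_a=\frac{1}{|N_{\mathbb Q}(a)|}\,{\textstyle\bigwedge}^q(a)\qquad(a\in\mathscr{S}),$$ where for $q=d$ the formula is read inside $\bigwedge^d_{\mathbb Q}\mathscr{A}$ via the canonical injection $\bigwedge^d_{\mathbb Z}R\hookrightarrow\bigwedge^d_{\mathbb Q}\mathscr{A}$. Here canonical means that for $q\le d$ and $r_1,\dots,r_q\in R$ the element $r_1\wedge\cdots\wedge r_q$ corresponds to the class of the inhomogeneous cycle $\sum_{\pi}\operatorname{sign}(\pi)\,[r_{\pi(1)}|\cdots|r_{\pi(q)}]\otimes 1_{\overline{R}}$, where $\pi$ runs over the permutations of $\{1,\dots,q\}$ and $1_{\overline{R}}$ is the characteristic function of $\overline{R}\subseteq\overline{\mathscr{A}}$; that is, to the image of $r_1\wedge\cdots\wedge r_q$ under the Pontryagin product isomorphism $\bigwedge^qR\cong H_q(R,\mathbb{Z})$ followed by the map $H_q(R,\mathbb{Z})\to H_q(\mathscr{A},\mathbb{Z}\overline{\mathscr{A}})$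 induced by $R\subseteq\mathscr{A}$ and $1\mapsto 1_{\overline{R}}$. -/

import Mathlib

open scoped TensorProduct CompactlySupported OreLocalization
open CategoryTheory

namespace RingHomology

/-! ## The algebraic action `S ↷ R` -/

/-- `S` is a reversible submonoid of the monoid of left regular elements of `R`
(those `a` with `a * x = 0 → x = 0`), and it contains all positive integers. -/
class IsAdmissible {R : Type} [Ring R] (S : Submonoid R) : Prop where
  isLeftRegular : ∀ s ∈ S, IsLeftRegular s
  left_reversible : ∀ s t : S, ∃ p q : S, s * p = t * q
  right_reversible : ∀ s t : S, ∃ p q : S, p * s = q * t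
  natCast_mem : ∀ n : ℕ, 0 < n → (n : R) ∈ S

section Completion

variable {R : Type} [Ring R] (S : Submonoid R)

/-- The `S`-constructible subgroups of `R`: the subgroups obtained from `R` by finitely many
images and preimages under the maps `σ_s : x ↦ s * x`, `s ∈ S`. -/
inductive IsConstructible : AddSubgroup R → Prop
  | top : IsConstructible ⊤
  | image (s : S) {C : AddSubgroup R} (hC : IsConstructible C) :
      IsConstructible (C.map (AddMonoidHom.mulLeft (s : R)))
  | preimage (s : S) {C : AddSubgroup R} (hC : IsConstructible C) :
      IsConstructible (C.comap (AddMonoidHom.mulLeft (s : R)))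

/-- The family of constructible subgroups. -/
abbrev Constructible : Type := {C : AddSubgroup R // IsConstructible S C}

variable {S} in
/-- The constructible subgroup `σ_s⁻¹ C`. -/
def Constructible.preimage (s : S) (C : Constructible S) : Constructible S :=
  ⟨C.1.comap (AddMonoidHom.mulLeft (s : R)), .preimage s C.2⟩

/-- The compatible families in `∏_C R ⧸ C`. -/
def completionSubgroup : AddSubgroup (∀ C : Constructible S, R ⧸ C.1) where
  carrier := {x | ∀ (C D : Constructible S) (h : C.1 ≤ D.1),
    QuotientAddGroup.map C.1 D.1 (AddMonoidHom.id R) h (x C) = x D}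
  zero_mem' := fun C D h => by simp
  add_mem' := fun {x y} hx hy C D h => by simp [hx C D h, hy C D h]
  neg_mem' := fun {x} hx C D h => by simp [hx C D h]

/-- The inverse limit `R̄ = lim_C R ⧸ C` over the constructible subgroups `C`. -/
def Completion : Type := completionSubgroup S

namespace Completion

instance : AddCommGroup (Completion S) := inferInstanceAs (AddCommGroup (completionSubgroup S))

/-- The topology of `∏_C R ⧸ C`, the product of the discrete topologies. -/
abbrev piTopology : TopologicalSpace (∀ C : Constructible S, R ⧸ C.1) :=
  @Pi.topologicalSpace _ _ (fun _ => ⊥)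

/-- `R̄` carries the subspace topology of the product of the discrete spaces `R ⧸ C`. -/
instance : TopologicalSpace (Completion S) :=
  (piTopology S).induced (fun x : completionSubgroup S => x.1)

variable {S}

/-- The component of an element of `R̄` in `R ⧸ C`. -/
def proj (C : Constructible S) : Completion S →+ R ⧸ C.1 where
  toFun x := x.1 C
  map_zero' := rfl
  map_add' _ _ := rfl

@[ext] theorem ext {x y : Completion S} (h : ∀ C, proj C x = proj C y) : x = y :=
  Subtype.ext (funext h)

theorem map_proj (x : Completion S) (C D : Constructible S) (h : C.1 ≤ D.1) :
    QuotientAddGroup.map C.1 D.1 (AddMonoidHom.id R) h (proj C x) = proj D x := x.2 C D h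

theorem continuous_iff {Y : Type*} [TopologicalSpace Y] {f : Y → Completion S} :
    Continuous f ↔ ∀ C, @Continuous _ _ _ ⊥ (fun y => proj C (f y)) := by
  let (C : Constructible S) : TopologicalSpace (R ⧸ C.1) := ⊥
  exact continuous_induced_rng.trans continuous_pi_iff

theorem continuous_proj (C : Constructible S) :
    @Continuous _ _ _ ⊥ (proj C) := continuous_iff.1 continuous_id C

instance : ContinuousAdd (Completion S) where
  continuous_add := by
    refine continuous_iff.2 fun C => ?_
    let : TopologicalSpace (R ⧸ C.1) := ⊥
    have : DiscreteTopology (R ⧸ C.1) := ⟨rfl⟩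
    simp only [map_add]
    exact ((continuous_proj C).comp continuous_fst).add ((continuous_proj C).comp continuous_snd)

/-- The canonical map `R → R̄`. -/
def of : R →+ Completion S where
  toFun r := ⟨fun C => (r : R ⧸ C.1), fun _ _ _ => rfl⟩
  map_zero' := rfl
  map_add' _ _ := rfl

@[simp] theorem proj_of (C : Constructible S) (r : R) :
    proj C (of r) = (r : R ⧸ C.1) := rfl

/-- The map `R ⧸ σ_s⁻¹ C → R ⧸ C` induced by `σ_s`. -/
def mulQuot (s : S) (C : Constructible S) : R ⧸ (C.preimage s).1 →+ R ⧸ C.1 :=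
  QuotientAddGroup.map _ _ (AddMonoidHom.mulLeft (s : R)) le_rfl

/-- The extension of `σ_s` to `R̄`: its component at `C` is the image of the component
at `σ_s⁻¹ C` under the map induced by `σ_s`. -/
instance : SMul S (Completion S) where
  smul s x := ⟨fun C => mulQuot s C (proj (C.preimage s) x), fun C D h => by
    beta_reduce
    rw [← map_proj x (C.preimage s) (D.preimage s) (AddSubgroup.comap_mono h)]
    generalize proj (C.preimage s) x = z
    induction z using QuotientAddGroup.induction_on with
    | _ z => rfl⟩

theorem proj_smul (s : S) (x : Completion S) (C : Constructible S) :
    proj C (s • x) = mulQuot s C (proj (C.preimage s) x) := rfl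

instance : DistribMulAction S (Completion S) where
  one_smul x := by
    ext C
    rw [proj_smul, ← map_proj x (C.preimage 1) C (fun y hy => by
      simpa [Constructible.preimage] using hy)]
    generalize proj (C.preimage 1) x = z
    induction z using QuotientAddGroup.induction_on with
    | _ z => exact congrArg _ (one_mul z)
  mul_smul s t x := by
    ext C
    rw [proj_smul, proj_smul, proj_smul,
      ← map_proj x (C.preimage (s * t)) ((C.preimage s).preimage t) (fun y hy => by
        simpa [Constructible.preimage, mul_assoc] using hy)]
    generalize proj (C.preimage (s * t)) x = z
    induction z using QuotientAddGroup.induction_on with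
    | _ z => exact congrArg _ (mul_assoc (s : R) t z)
  smul_zero s := by ext C; simp [proj_smul]
  smul_add s x y := by ext C; simp [proj_smul]

theorem smul_of (s : S) (r : R) : s • (of r : Completion S) = of ((s : R) * r) := rfl

theorem continuous_smul (s : S) : Continuous (fun x : Completion S => s • x) := by
  refine continuous_iff.2 fun C => ?_
  let (C : Constructible S) : TopologicalSpace (R ⧸ C.1) := ⊥
  have (C : Constructible S) : DiscreteTopology (R ⧸ C.1) := ⟨rfl⟩
  exact continuous_of_discreteTopology (f := mulQuot s C) |>.comp
    (continuous_proj (C.preimage s))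

end Completion

/-! ## The algebra `𝒜 = R ⊗ ℚ` -/

variable (R) in
/-- The `ℚ`-algebra `𝒜 = R ⊗ ℚ`. -/
abbrev RatAlg : Type := ℚ ⊗[ℤ] R

theorem one_tmul_injective [Module.Free ℤ R] : Function.Injective (fun r : R => ((1 : ℚ) ⊗ₜ[ℤ] r : RatAlg R)) :=
  Algebra.TensorProduct.includeRight_injective (R := ℤ) (A := ℚ) (B := R)
    (RingHom.injective_int _)

variable [Module.Finite ℤ R] [IsAdmissible S]

theorem isUnit_one_tmul (s : S) : IsUnit ((1 : ℚ) ⊗ₜ[ℤ] (s : R) : RatAlg R) := by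
  have h : IsLeftRegular ((1 : ℚ) ⊗ₜ[ℤ] (s : R) : RatAlg R) := by
    have h1 : Function.Injective
        ((LinearMap.mulLeft ℤ (s : R)).baseChange ℚ) :=
      Module.Flat.lTensor_preserves_injective_linearMap (M := ℚ) _
        (IsAdmissible.isLeftRegular (s : R) s.2)
    have h2 : (LinearMap.mulLeft ℤ (s : R)).baseChange ℚ =
        LinearMap.mulLeft ℚ ((1 : ℚ) ⊗ₜ[ℤ] (s : R) : RatAlg R) := by
      ext x
      simp
    rw [h2] at h1
    exact h1
  have : IsArtinianRing (RatAlg R)ᵐᵒᵖ := IsArtinianRing.of_finite ℚ _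
  exact IsArtinianRing.isUnit_iff_isLeftRegular.2 h

variable [Module.Free ℤ R]

/-- The left Ore condition for `S` as a subset of itself, that is, right reversibility. -/
noncomputable instance oreSet : OreLocalization.OreSet (⊤ : Submonoid S) where
  ore_right_cancel r₁ r₂ s h := by
    refine ⟨1, ?_⟩
    have h1 : (r₁ : R) * (s.1 : R) = (r₂ : R) * (s.1 : R) := congrArg Subtype.val h
    have h2 := congrArg (fun r : R => ((1 : ℚ) ⊗ₜ[ℤ] r : RatAlg R)) h1
    have h3 : ((1 : ℚ) ⊗ₜ[ℤ] (r₁ : R) : RatAlg R) * ((1 : ℚ) ⊗ₜ[ℤ] (s.1 : R)) =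
        ((1 : ℚ) ⊗ₜ[ℤ] (r₂ : R)) * ((1 : ℚ) ⊗ₜ[ℤ] (s.1 : R)) := by
      simpa using h2
    have h4 := one_tmul_injective ((isUnit_one_tmul S s.1).mul_right_cancel h3)
    rw [Subtype.ext h4]
  oreNum r s := (IsAdmissible.right_reversible r s.1).choose_spec.choose
  oreDenom r s := ⟨(IsAdmissible.right_reversible r s.1).choose, trivial⟩
  ore_eq r s := (IsAdmissible.right_reversible r s.1).choose_spec.choose_spec

/-- The group of left quotients `𝒮 = S⁻¹S`; `s /ₒ t` is the quotient `t⁻¹s`. -/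
abbrev QuotGroup : Type := OreLocalization (⊤ : Submonoid S) S

namespace QuotGroup

noncomputable instance : Group (QuotGroup S) :=
  groupOfIsUnit fun a => by
    induction a using OreLocalization.ind with
    | _ s t =>
      exact ⟨⟨s /ₒ t, t.1 /ₒ ⟨s, trivial⟩,
        OreLocalization.mul_inv (S := (⊤ : Submonoid S)) ⟨s, trivial⟩ t,
        OreLocalization.mul_inv (S := (⊤ : Submonoid S)) t ⟨s, trivial⟩⟩, rfl⟩

/-- The inclusion `S ⊆ 𝒜ˣ`. -/
noncomputable def unitsOf : S →* (RatAlg R)ˣ :=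
  IsUnit.liftRight
    ((Algebra.TensorProduct.includeRight (R := ℤ) (A := ℚ) (B := R) : R →* RatAlg R).comp
      S.subtype)
    (isUnit_one_tmul S)

theorem coe_unitsOf (s : S) : (unitsOf S s : RatAlg R) = 1 ⊗ₜ (s : R) := rfl

/-- The inclusion `𝒮 ⊆ 𝒜ˣ`, `s /ₒ t ↦ t⁻¹ * s`. -/
noncomputable def embed : QuotGroup S →* (RatAlg R)ˣ :=
  OreLocalization.universalMulHom (unitsOf S)
    (toUnits.toMonoidHom.comp ((unitsOf S).comp (⊤ : Submonoid S).subtype)) (fun _ => rfl)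

variable {S}

theorem embed_oreDiv (s : S) (t : (⊤ : Submonoid S)) :
    embed S (s /ₒ t) = (unitsOf S t.1)⁻¹ * unitsOf S s := rfl

theorem embed_injective : Function.Injective (embed S) := by
  refine (injective_iff_map_eq_one _).2 fun a ha => ?_
  induction a using OreLocalization.ind with
  | _ s t =>
    rw [embed_oreDiv, inv_mul_eq_one] at ha
    have h1 : (t.1 : R) = s := one_tmul_injective (congrArg Units.val ha)
    have h2 : t.1 = s := Subtype.ext h1
    rw [← h2]
    exact OreLocalization.div_eq_one

end QuotGroup

/-! ## The locally compact group `𝒜̄` -/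

/-- The direct limit `𝒜̄ = lim_{s ∈ S} (R̄, σ_s)` along right divisibility: its elements are
the classes `x /ₒ s = ι_s(x)` with `x ∈ R̄` and `s ∈ S`, where `x /ₒ s = y /ₒ t` if and only if
`p * s = q * t` and `σ_p x = σ_q y` for some `p, q ∈ S`. The action of `𝒮` on `𝒜̄` which
extends the action of `S` is the scalar multiplication by `QuotGroup S`. -/
abbrev FullCompletion : Type := OreLocalization (⊤ : Submonoid S) (Completion S)

namespace FullCompletion

/-- The direct limit topology: the finest one for which all `ι_s : R̄ → 𝒜̄` are continuous. -/
noncomputable instance : TopologicalSpace (FullCompletion S) :=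
  ⨆ s : (⊤ : Submonoid S),
    TopologicalSpace.coinduced (fun x : Completion S => (x /ₒ s : FullCompletion S)) inferInstance

variable {S}

theorem oreDiv_eq_iff' {x y : Completion S} {s t : (⊤ : Submonoid S)} :
    (x /ₒ s : FullCompletion S) = y /ₒ t ↔
      ∃ p q : S, p * s.1 = q * t.1 ∧ p • x = q • y := by
  rw [OreLocalization.oreDiv_eq_iff]
  constructor
  · rintro ⟨u, v, h1, h2⟩
    exact ⟨v, u.1, h2.symm, h1.symm⟩
  · rintro ⟨p, q, h1, h2⟩
    exact ⟨⟨q, trivial⟩, p, h2.symm, h1.symm⟩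

theorem continuous_oreDiv (s : (⊤ : Submonoid S)) :
    Continuous (fun x : Completion S => (x /ₒ s : FullCompletion S)) :=
  continuous_iSup_rng (i := s) continuous_coinduced_rng

theorem continuous_iff {Y : Type*} [TopologicalSpace Y] {f : FullCompletion S → Y} :
    Continuous f ↔ ∀ s : (⊤ : Submonoid S), Continuous (fun x : Completion S => f (x /ₒ s)) :=
  continuous_iSup_dom.trans (forall_congr' fun _ => continuous_coinduced_dom)

theorem continuous_add_right (b : FullCompletion S) : Continuous (fun x => x + b) := by
  refine continuous_iff.2 fun s => ?_
  induction b using OreLocalization.ind with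
  | _ y t =>
    obtain ⟨p, q, h⟩ := IsAdmissible.right_reversible s.1 t.1
    have h2 (x : Completion S) : (x /ₒ s : FullCompletion S) + y /ₒ t =
        (p • x + q • y) /ₒ (⟨p, trivial⟩ * s) :=
      OreLocalization.oreDiv_add_char s t q ⟨p, trivial⟩ h
    simp only [h2]
    exact (continuous_oreDiv _).comp ((Completion.continuous_smul p).add continuous_const)

theorem continuous_smul (a : QuotGroup S) : Continuous (fun x : FullCompletion S => a • x) := by
  refine continuous_iff.2 fun s => ?_
  induction a using OreLocalization.ind with
  | _ r t =>
    obtain ⟨p, q, h⟩ := IsAdmissible.right_reversible r s.1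
    have h2 (x : Completion S) : (r /ₒ t : QuotGroup S) • (x /ₒ s : FullCompletion S) =
        (q • x) /ₒ (⟨p, trivial⟩ * t) :=
      OreLocalization.oreDiv_smul_char r x t s q ⟨p, trivial⟩ h
    simp only [h2]
    exact (continuous_oreDiv _).comp (Completion.continuous_smul q)

/-- Translation `x ↦ x + b` of `𝒜̄`. -/
noncomputable def translate (b : FullCompletion S) : FullCompletion S ≃ₜ FullCompletion S where
  toEquiv := Equiv.addRight b
  continuous_toFun := continuous_add_right b
  continuous_invFun := continuous_add_right (-b)

/-- The automorphism `σ̃_a` of `𝒜̄`. -/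
noncomputable def mulHomeo (a : QuotGroup S) : FullCompletion S ≃ₜ FullCompletion S where
  toEquiv := MulAction.toPerm a
  continuous_toFun := continuous_smul a
  continuous_invFun := continuous_smul a⁻¹

/-! ### The embedding `𝒜 → 𝒜̄` -/

variable (S) in
/-- The positive integer `n` as an element of `S`. -/
def posInt (n : ℕ) (hn : 0 < n) : (⊤ : Submonoid S) := ⟨⟨n, IsAdmissible.natCast_mem n hn⟩, trivial⟩

theorem posInt_smul (n : ℕ) (hn : 0 < n) (x : Completion S) :
    (posInt S n hn).1 • x = n • x := by
  ext C
  have hle : C.1 ≤ (C.preimage (posInt S n hn).1).1 := fun y hy => by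
    have h : (n : R) * y ∈ C.1 := by
      rw [← nsmul_eq_mul]
      exact C.1.nsmul_mem hy n
    exact h
  rw [Completion.proj_smul, map_nsmul, ← Completion.map_proj x C _ hle]
  generalize Completion.proj C x = z
  induction z using QuotientAddGroup.induction_on with
  | _ z => exact congrArg (QuotientAddGroup.mk (s := C.1)) (nsmul_eq_mul n z).symm

/-- The quotient `(k / n) x` of an element `x` of `R̄`. -/
theorem zsmul_oreDiv_eq (x : Completion S) {k k' : ℤ} {n n' : ℕ} (hn : 0 < n) (hn' : 0 < n')
    (h : k * n' = k' * n) :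
    ((k • x) /ₒ posInt S n hn : FullCompletion S) = (k' • x) /ₒ posInt S n' hn' := by
  refine oreDiv_eq_iff'.2 ⟨(posInt S n' hn').1, (posInt S n hn).1, ?_, ?_⟩
  · exact Subtype.ext (Nat.cast_commute n' (n : R))
  · rw [posInt_smul, posInt_smul, ← natCast_zsmul, ← natCast_zsmul, smul_smul, smul_smul,
      mul_comm, h, mul_comm]

theorem add_zsmul_oreDiv (x : Completion S) (k k' : ℤ) {n n' : ℕ} (hn : 0 < n) (hn' : 0 < n') :
    ((k • x) /ₒ posInt S n hn + (k' • x) /ₒ posInt S n' hn' : FullCompletion S) =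
      ((k * n' + k' * n) • x) /ₒ posInt S (n * n') (Nat.mul_pos hn hn') := by
  rw [zsmul_oreDiv_eq x (k' := k * n') hn (Nat.mul_pos hn hn') (by push_cast; ring),
    zsmul_oreDiv_eq x (k := k') (k' := k' * n) hn' (Nat.mul_pos hn hn') (by push_cast; ring),
    OreLocalization.add_oreDiv, ← add_smul]

variable (S) in
/-- The inclusion `𝒜 → 𝒜̄`, `(k / n) ⊗ r ↦ ι_n(k r)`. -/
noncomputable def ofRat : RatAlg R →+ FullCompletion S :=
  TensorProduct.liftAddHom
    { toFun := fun q =>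
        { toFun := fun r => (q.num • Completion.of r) /ₒ posInt S q.den q.pos
          map_zero' := by simp
          map_add' := fun r r' => by simp [smul_add] }
      map_zero' := by
        ext r
        simp
      map_add' := fun q q' => by
        ext r
        simp only [AddMonoidHom.coe_mk, ZeroHom.coe_mk, AddMonoidHom.add_apply]
        rw [add_zsmul_oreDiv]
        refine zsmul_oreDiv_eq _ _ _ ?_
        have := Rat.add_num_den' q q'
        push_cast
        linarith }
    (fun k q r => by
      change (((k • q).num • Completion.of r) /ₒ _ : FullCompletion S) =
        (q.num • Completion.of (k • r)) /ₒ _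
      rw [map_zsmul, smul_smul]
      refine zsmul_oreDiv_eq _ _ _ ?_
      have h : ((k • q : ℚ).num : ℚ) / (k • q : ℚ).den = k * (q.num / q.den) := by
        rw [Rat.num_div_den, Rat.num_div_den, zsmul_eq_mul]
      have h1 : ((k • q : ℚ).den : ℚ) ≠ 0 := by exact_mod_cast (k • q : ℚ).den_nz
      have h2 : (q.den : ℚ) ≠ 0 := by exact_mod_cast q.den_nz
      field_simp at h
      have h3 : ((k • q : ℚ).num : ℚ) * q.den = q.num * k * (k • q : ℚ).den := by linarith
      exact_mod_cast h3)

theorem ofRat_tmul (k : ℤ) (n : ℕ) (hn : 0 < n) (r : R) :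
    ofRat S (((k : ℚ) / n) ⊗ₜ r) = (k • Completion.of r) /ₒ posInt S n hn := by
  refine zsmul_oreDiv_eq _ _ _ ?_
  set q : ℚ := (k : ℚ) / n with hq
  have h : (q.num : ℚ) / q.den = k / n := by rw [Rat.num_div_den]
  have h1 : (n : ℚ) ≠ 0 := by exact_mod_cast hn.ne'
  have h2 : (q.den : ℚ) ≠ 0 := by exact_mod_cast q.den_nz
  rw [div_eq_div_iff h2 h1] at h
  exact_mod_cast h

/-- `ofRat` is equivariant for `𝒮`. -/
theorem ofRat_smul (a : QuotGroup S) (x : RatAlg R) :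
    ofRat S (QuotGroup.embed S a * x) = a • ofRat S x := by
  have key (s : S) (x : RatAlg R) : ofRat S ((QuotGroup.unitsOf S s : RatAlg R) * x) =
      (s /ₒ (1 : (⊤ : Submonoid S)) : QuotGroup S) • ofRat S x := by
    induction x using TensorProduct.induction_on with
    | zero => simp
    | add x y hx hy => rw [mul_add, map_add, map_add, smul_add, hx, hy]
    | tmul q r =>
      rw [QuotGroup.coe_unitsOf, Algebra.TensorProduct.tmul_mul_tmul, one_mul]
      change ((q.num • Completion.of ((s : R) * r)) /ₒ _ : FullCompletion S) =
        _ • ((q.num • Completion.of r) /ₒ _)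
      have hc : ((posInt S q.den q.pos : (⊤ : Submonoid S)) : S) * s =
          s * (posInt S q.den q.pos : (⊤ : Submonoid S)) :=
        Subtype.ext (Nat.cast_commute q.den (s : R))
      rw [OreLocalization.oreDiv_smul_char s _ 1 _ s (posInt S q.den q.pos) hc, mul_one, ← Completion.smul_of,
        smul_comm]
  have key' (s : S) (x : RatAlg R) : ofRat S (((QuotGroup.unitsOf S s)⁻¹ : (RatAlg R)ˣ) * x) =
      (s /ₒ (1 : (⊤ : Submonoid S)) : QuotGroup S)⁻¹ • ofRat S x := by
    rw [eq_inv_smul_iff, ← key, Units.mul_inv_cancel_left]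
  induction a using OreLocalization.ind with
  | _ s t =>
    have h : (s /ₒ t : QuotGroup S) =
        (t.1 /ₒ (1 : (⊤ : Submonoid S)))⁻¹ * (s /ₒ (1 : (⊤ : Submonoid S))) := by
      rw [eq_inv_mul_iff_mul_eq]
      exact OreLocalization.mul_cancel (S := (⊤ : Submonoid S)) (s := t) (t := 1)
    rw [QuotGroup.embed_oreDiv, Units.val_mul, mul_assoc, key', key, smul_smul, ← h]

end FullCompletion

/-! ## Homology of `𝒜` with coefficients in `ℤ𝒜̄` -/

/-- `ℤX = C_c(X, ℤ)`, for `X = 𝒜̄`. -/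
abbrev Coeff : Type := C_c(FullCompletion S, ℤ)

/-- The map `f ↦ f ∘ e⁻¹` on `C_c(X, ℤ)`, for a homeomorphism `e`. -/
noncomputable def pushforward {X : Type} [TopologicalSpace X] (e : X ≃ₜ X) :
    C_c(X, ℤ) →ₗ[ℤ] C_c(X, ℤ) where
  toFun f :=
    { toFun := f ∘ e.symm
      continuous_toFun := f.continuous.comp e.symm.continuous
      hasCompactSupport' := f.hasCompactSupport.comp_homeomorph e.symm }
  map_add' _ _ := rfl
  map_smul' _ _ := rfl

theorem pushforward_apply {X : Type} [TopologicalSpace X] (e : X ≃ₜ X) (f : C_c(X, ℤ)) (x : X) :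
    pushforward e f x = f (e.symm x) := rfl

/-- The action of `𝒜` on `ℤ𝒜̄` by translation, `(b • f) x = f (x - b)`. -/
noncomputable def translationRep : Representation ℤ (Multiplicative (RatAlg R)) (Coeff S) where
  toFun b := pushforward (FullCompletion.translate (FullCompletion.ofRat S b.toAdd))
  map_one' := by
    ext f x
    change f (x + -FullCompletion.ofRat S 0) = f x
    simp
  map_mul' b c := by
    ext f x
    change f (x + -FullCompletion.ofRat S (b.toAdd + c.toAdd)) =
      f (x + -FullCompletion.ofRat S b.toAdd + -FullCompletion.ofRat S c.toAdd)
    congr 1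
    rw [map_add]
    abel

/-- The `𝒜`-module `ℤ𝒜̄`. -/
noncomputable abbrev coeffRep : Rep.{0} ℤ (Multiplicative (RatAlg R)) := Rep.of (translationRep S)

/-- The group homology `H_q(𝒜, ℤ𝒜̄)`. -/
noncomputable abbrev Homology (q : ℕ) : ModuleCat ℤ := groupHomology (coeffRep S) q

variable {S}

/-- The automorphism `x ↦ a x` of the group `𝒜`, for `a ∈ 𝒮`. -/
noncomputable def mulHom (a : QuotGroup S) :
    Multiplicative (RatAlg R) →* Multiplicative (RatAlg R) :=
  AddMonoidHom.toMultiplicative (AddMonoidHom.mulLeft (QuotGroup.embed S a : RatAlg R))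

/-- The map `α_a : f ↦ f ∘ σ̃_a⁻¹` on `ℤ𝒜̄`, which is equivariant along `x ↦ a x`. -/
noncomputable def coeffMap (a : QuotGroup S) :
    coeffRep S ⟶ Rep.res (mulHom a) (coeffRep S) :=
  Rep.ofHom (LinearMap.intertwiningMap_of_isIntertwiningMap _ _
    (pushforward (FullCompletion.mulHomeo a)) (fun b f => by
      ext x
      change f (a⁻¹ • x + -FullCompletion.ofRat S b.toAdd) =
        f (a⁻¹ • (x + -FullCompletion.ofRat S (QuotGroup.embed S a * b.toAdd)))
      rw [FullCompletion.ofRat_smul, smul_add, smul_neg, inv_smul_smul]))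

/-- The action `θ_a` of `a ∈ 𝒮` on `H_q(𝒜, ℤ𝒜̄)`: the map induced by the pair
`(x ↦ a x, α_a)`. -/
noncomputable def theta (a : QuotGroup S) (q : ℕ) : Homology S q ⟶ Homology S q :=
  groupHomology.map (mulHom a) (coeffMap a) q

/-- `N_ℚ(a)`, the determinant of the `ℚ`-linear map `x ↦ a x` on `𝒜`. -/
noncomputable def ratNorm (a : QuotGroup S) : ℚ :=
  LinearMap.det (LinearMap.mulLeft ℚ (QuotGroup.embed S a : RatAlg R))

/-- The exterior power `⋀^q(a)` of the map `x ↦ a x` on `𝒜`. -/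
noncomputable def extMul (a : QuotGroup S) (q : ℕ) : ⋀[ℚ]^q (RatAlg R) →ₗ[ℚ] ⋀[ℚ]^q (RatAlg R) :=
  exteriorPower.map q (LinearMap.mulLeft ℚ (QuotGroup.embed S a : RatAlg R))

/-- The class in `H_q(𝒜, ℤ𝒜̄)` of `r₁ ∧ ⋯ ∧ r_q ∈ ⋀^q R`: it is represented by the inhomogeneous
cycle `∑_π sign(π) [r_π(1) | ⋯ | r_π(q)] ⊗ 1_R̄`, where `1_R̄` is the characteristic function
of `R̄ = ι_1(R̄)`. This is the image of `r₁ ∧ ⋯ ∧ r_q` under the Pontryagin product isomorphism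
`⋀^q R ≅ H_q(R, ℤ)` followed by the map induced by `R ⊆ 𝒜` and `ℤ → ℤ𝒜̄`, `1 ↦ 1_R̄`. -/
def IsWedgeClass {q : ℕ} (r : Fin q → R) (c : Homology S q) : Prop :=
  ∃ (u : Coeff S) (z : groupHomology.cycles (coeffRep S) q),
    (∀ x, x ∈ Set.range (fun y : Completion S => (y /ₒ 1 : FullCompletion S)) → u x = 1) ∧
    (∀ x, x ∉ Set.range (fun y : Completion S => (y /ₒ 1 : FullCompletion S)) → u x = 0) ∧
    groupHomology.iCycles (coeffRep S) q z =
      ∑ π : Equiv.Perm (Fin q), (Equiv.Perm.sign π : ℤ) •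
        Finsupp.single (fun i => Multiplicative.ofAdd (1 ⊗ₜ r (π i) : RatAlg R)) u ∧
    groupHomology.π (coeffRep S) q z = c

end Completion

/-- The canonical map `⋀_ℤ^q R → ⋀_ℚ^q 𝒜`, `r₁ ∧ ⋯ ∧ r_q ↦ (1 ⊗ r₁) ∧ ⋯ ∧ (1 ⊗ r_q)`. -/
noncomputable def extBaseChange (R : Type) [Ring R] (q : ℕ) :
    ⋀[ℤ]^q R →ₗ[ℤ] ⋀[ℚ]^q (RatAlg R) :=
  exteriorPower.alternatingMapLinearEquiv
    { ((exteriorPower.ιMulti ℚ q (M := RatAlg R)).toMultilinearMap.restrictScalars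
        ℤ).compLinearMap (fun _ => TensorProduct.mk ℤ ℚ R 1) with
      map_eq_zero_of_eq' := fun v _ _ h hij =>
        (exteriorPower.ιMulti ℚ q (M := RatAlg R)).map_eq_zero_of_eq
          (fun i => (1 ⊗ₜ v i : RatAlg R)) (congrArg _ h) hij }

theorem extBaseChange_ιMulti {R : Type} [Ring R] {q : ℕ} (r : Fin q → R) :
    extBaseChange R q (exteriorPower.ιMulti ℤ q r) =
      exteriorPower.ιMulti ℚ q (fun i => (1 ⊗ₜ r i : RatAlg R)) := by
  rw [extBaseChange, exteriorPower.alternatingMapLinearEquiv_apply_ιMulti]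
  rfl

end RingHomology

/-!
The isomorphism is induced by an explicit map on bar chains. The characteristic functions of the
cosets of the sets `a R̄`, `a ∈ 𝒮`, span `ℤ𝒜̄`, and there is a translation invariant functional
`∫ : ℤ𝒜̄ → ℚ` (`integralHom`), a Haar integral with `∫ 1_R̄ = 1` and
`∫ f ∘ σ̃_a⁻¹ = |N(a)|⁻¹ ∫ f`. The map
`[x₁ | ⋯ | x_q] ⊗ f ↦ (1 / q!) (∫ f) x₁ ∧ ⋯ ∧ x_q` (`wedgeIntegral`) kills boundaries, because
`(x₁, …, x_q) ↦ x₁ ∧ ⋯ ∧ x_q` is multilinear and `∫` is invariant, so it induces a map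
`comparison` from `H_q(𝒜, ℤ𝒜̄)` to `⋀^q 𝒜`. It sends the class of `r₁ ∧ ⋯ ∧ r_q` to
`(1 ⊗ r₁) ∧ ⋯ ∧ (1 ⊗ r_q)`, and it takes `θ_a` to `|N(a)|⁻¹ ⋀^q(a)` (`comparison_theta`): both are
visible on chains. What remains is that it is injective, and what its image is.

Every function in `ℤ𝒜̄` is invariant under some `n R̄` with `n > 0`, hence comes from the module
`ℤ[𝒜 / n R]` (`exists_stepMap_eq`). By Shapiro's lemma, `H_q(𝒜, ℤ[𝒜 / H]) = H_q(H, ℤ) = ⋀^q H` for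
a lattice `H`. Only half of this is needed: for `H` with basis `t₁, …, t_k`, the homology is
generated by the classes of the alternating chains on `t_{i₁}, …, t_{i_q}`, `i₁ < ⋯ < i_q`, with
coefficient the coset of `0`. This is `isWedgeSpanned_quotRep`, by induction on `k`: the
endomorphism `t⁻¹ - 1` gives an exact sequence
`0 → ℤ[𝒜 / H] → ℤ[𝒜 / H] → ℤ[𝒜 / (H + ℤ t)] → 0`, and the case `k = 0` is the acyclicity of
`ℤ[𝒜]`. Consequently (`comparison_decomposition`) a class `c` in `H_q(𝒜, ℤ𝒜̄)` is an integral
combination of the alternating classes on `n b_{i₁}, …, n b_{i_q}` with coefficient `1_{n R̄}`, where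
`b₁, …, b_d` is a basis of `R`, and `comparison` sends each of them to `n^{q-d}` times
`b_{i₁} ∧ ⋯ ∧ b_{i_q}`. Since these wedges are linearly independent over `ℚ`, `comparison` is
injective; there are none for `q > d`, and for `q = d` the image is `⋀^d R`. For `q < d` the operator
`θ_n` acts as `n^{q-d}`, so the image is divisible, hence a `ℚ`-subspace; it contains the wedges of
elements of `R`, which span `⋀^q 𝒜`.
-/

namespace RingHomology

open Finsupp

/-! ### Alternating chains on commuting elements -/

section Chains

variable {G : Type} [Group G]

/-- The differential of inhomogeneous chains, as an additive map. -/
noncomputable def chainD (M : Rep.{0} ℤ G) (n : ℕ) :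
    ((Fin (n + 1) → G) →₀ M) →+ ((Fin n → G) →₀ M) :=
  (groupHomology.inhomogeneousChains.d M n).hom.toAddMonoidHom

theorem chainD_single (M : Rep.{0} ℤ G) (n : ℕ) (g : Fin (n + 1) → G) (a : M) :
    chainD M n (single g a) = single (fun i => g i.succ) (M.ρ (g 0)⁻¹ a) +
      ∑ j : Fin (n + 1), (-1 : ℤ) ^ ((j : ℕ) + 1) • single (Fin.contractNth j (· * ·) g) a := by
  refine (groupHomology.inhomogeneousChains.d_single n g a).trans ?_
  congr 1
  exact Finset.sum_congr rfl fun j _ => Finsupp.ext fun x => int_smul_eq_zsmul M.hV2 _ _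

theorem chainD_chainD (M : Rep.{0} ℤ G) (n : ℕ) (y : (Fin (n + 2) → G) →₀ M) :
    chainD M n (chainD M (n + 1) y) = 0 :=
  congrArg (fun f => f.hom y) (groupHomology.inhomogeneousChains.d_comp_d (A := M) (n := n))

theorem chainD_mapRange {M N : Rep.{0} ℤ G} (f : M →+ N)
    (hf : ∀ g m, f (M.ρ g m) = N.ρ g (f m)) (n : ℕ) (y : (Fin (n + 1) → G) →₀ M) :
    chainD N n (mapRange.addMonoidHom f y) = mapRange.addMonoidHom f (chainD M n y) := by
  suffices h : (chainD N n).comp (mapRange.addMonoidHom f) =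
      (mapRange.addMonoidHom f).comp (chainD M n) from DFunLike.congr_fun h y
  refine addHom_ext fun g a => ?_
  simp only [AddMonoidHom.comp_apply, chainD_single, map_add, map_sum, map_zsmul,
    mapRange.addMonoidHom_apply, mapRange_single, hf]

end Chains

section WedgeChain

variable {G : Type}

/-- The alternating sum `∑_π sign(π) [t_π(1) | ⋯ | t_π(q)] ⊗ u`. -/
noncomputable def wedgeChain {M : Type} [AddCommGroup M] {q : ℕ} (t : Fin q → G) :
    M →+ ((Fin q → G) →₀ M) :=
  ∑ π : Equiv.Perm (Fin q), (Equiv.Perm.sign π : ℤ) • singleAddHom (fun i => t (π i))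

theorem wedgeChain_apply {M : Type} [AddCommGroup M] {q : ℕ} (t : Fin q → G) (u : M) :
    wedgeChain t u =
      ∑ π : Equiv.Perm (Fin q), (Equiv.Perm.sign π : ℤ) • single (fun i => t (π i)) u := by
  simp [wedgeChain, AddMonoidHom.finsetSum_apply]

theorem mapRange_wedgeChain {M N : Type} [AddCommGroup M] [AddCommGroup N] (f : M →+ N) {q : ℕ}
    (t : Fin q → G) (u : M) :
    mapRange.addMonoidHom f (wedgeChain t u) = wedgeChain t (f u) := by
  simp only [wedgeChain_apply, map_sum, map_zsmul, mapRange.addMonoidHom_apply, mapRange_single]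

end WedgeChain

section CommChains

variable {G : Type} [CommGroup G]

theorem contractNth_comp_swap {n : ℕ} (i : Fin n) (g : Fin (n + 1) → G) :
    Fin.contractNth i.castSucc (· * ·) (fun k => g (Equiv.swap i.castSucc i.succ k)) =
      Fin.contractNth i.castSucc (· * ·) g := by
  funext k
  rcases lt_trichotomy (k : ℕ) i with h | h | h
  · rw [Fin.contractNth_apply_of_lt _ _ _ _ h, Fin.contractNth_apply_of_lt _ _ _ _ h,
      Equiv.swap_apply_of_ne_of_ne]
    · exact fun e => absurd (congrArg Fin.val e) (by simp; omega)
    · exact fun e => absurd (congrArg Fin.val e) (by simp; omega)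
  · obtain rfl : k = i := Fin.ext h
    rw [Fin.contractNth_apply_of_eq _ _ _ _ h, Fin.contractNth_apply_of_eq _ _ _ _ h,
      Equiv.swap_apply_left, Equiv.swap_apply_right, mul_comm]
  · rw [Fin.contractNth_apply_of_gt _ _ _ _ h, Fin.contractNth_apply_of_gt _ _ _ _ h,
      Equiv.swap_apply_of_ne_of_ne]
    · exact fun e => absurd (congrArg Fin.val e) (by simp; omega)
    · exact fun e => absurd (congrArg Fin.val e) (by simp; omega)

theorem contractNth_last {n : ℕ} (g : Fin (n + 1) → G) :
    Fin.contractNth (Fin.last n) (· * ·) g = fun k => g k.castSucc :=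
  funext fun k => Fin.contractNth_apply_of_lt _ _ _ _ k.2

/-- The inner faces of an alternating chain cancel in pairs because the letters commute; the
last face is turned into the first one by a cyclic rotation. -/
theorem chainD_wedgeChain_eq_sum (M : Rep.{0} ℤ G) {n : ℕ} (t : Fin (n + 1) → G) (u : M) :
    chainD M n (wedgeChain t u) = ∑ π : Equiv.Perm (Fin (n + 1)), (Equiv.Perm.sign π : ℤ) •
      single (fun i : Fin n => t (π i.succ)) (M.ρ (t (π 0))⁻¹ u - u) := by
  have inner (i : Fin n) : ∑ π : Equiv.Perm (Fin (n + 1)), (Equiv.Perm.sign π : ℤ) •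
      single (Fin.contractNth i.castSucc (· * ·) (fun k => t (π k))) u = 0 := by
    refine Finset.sum_involution (fun π _ => π * Equiv.swap i.castSucc i.succ) ?_ ?_ ?_ ?_
    · intro π _
      have h := contractNth_comp_swap i (fun k => t (π k))
      simp only [Equiv.Perm.coe_mul, Function.comp_apply, Equiv.Perm.sign_mul]
      rw [h, Equiv.Perm.sign_swap (Fin.castSucc_lt_succ).ne]
      simp
    · intro π _ _ h
      have h2 : Equiv.swap i.castSucc i.succ = 1 := mul_eq_left.1 h
      exact (Fin.castSucc_lt_succ (i := i)).ne (Equiv.swap_eq_one_iff.1 h2)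
    · exact fun _ _ => Finset.mem_univ _
    · intro π _
      rw [mul_assoc, Equiv.swap_mul_self, mul_one]
  have outer : ∑ π : Equiv.Perm (Fin (n + 1)), (Equiv.Perm.sign π : ℤ) •
      (-1 : ℤ) ^ (n + 1) • single (fun i : Fin n => t (π i.castSucc)) u =
      - ∑ π : Equiv.Perm (Fin (n + 1)), (Equiv.Perm.sign π : ℤ) •
        single (fun i : Fin n => t (π i.succ)) u := by
    rw [← Finset.sum_neg_distrib, ← Equiv.sum_comp (Equiv.mulRight (finRotate (n + 1)))]
    refine Finset.sum_congr rfl fun π _ => ?_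
    have h (i : Fin n) : finRotate (n + 1) i.castSucc = i.succ := by
      rw [finRotate_apply, Fin.coeSucc_eq_succ]
    simp only [Equiv.coe_mulRight, Equiv.Perm.coe_mul, Function.comp_apply, h,
      Equiv.Perm.sign_mul, sign_finRotate, smul_smul, ← neg_smul]
    congr 1
    push_cast
    rw [pow_succ, mul_assoc, ← mul_assoc ((-1 : ℤ) ^ n), ← mul_pow]
    simp
  rw [wedgeChain_apply, map_sum]
  simp only [map_zsmul, chainD_single, smul_add, Finset.sum_add_distrib, Fin.sum_univ_castSucc,
    contractNth_last, Finset.smul_sum, Fin.val_last, outer]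
  rw [Finset.sum_comm]
  have : ∀ i : Fin n, ∑ π : Equiv.Perm (Fin (n + 1)), (Equiv.Perm.sign π : ℤ) •
      (-1 : ℤ) ^ ((i.castSucc : ℕ) + 1) •
        single (Fin.contractNth i.castSucc (· * ·) (fun k => t (π k))) u = 0 := by
    intro i
    simp only [smul_comm _ ((-1 : ℤ) ^ _)]
    rw [← Finset.smul_sum, inner, smul_zero]
  rw [Finset.sum_eq_zero fun i _ => this i, zero_add, ← sub_eq_add_neg, ← Finset.sum_sub_distrib]
  exact Finset.sum_congr rfl fun π _ => by rw [single_sub, smul_sub]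

theorem chainD_wedgeChain_of_forall_fixed (M : Rep.{0} ℤ G) {n : ℕ} (t : Fin (n + 1) → G) (u : M)
    (hu : ∀ i, M.ρ (t i)⁻¹ u = u) : chainD M n (wedgeChain t u) = 0 := by
  rw [chainD_wedgeChain_eq_sum]
  exact Finset.sum_eq_zero fun π _ => by rw [hu, sub_self, single_zero, smul_zero]

/-- If all letters but the first fix `u`, only the permutations which leave the first letter in
place contribute to the boundary. -/
theorem chainD_wedgeChain_of_forall_succ_fixed (M : Rep.{0} ℤ G) {n : ℕ} (t : Fin (n + 1) → G)
    (u : M) (hu : ∀ i : Fin n, M.ρ (t i.succ)⁻¹ u = u) :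
    chainD M n (wedgeChain t u) =
      wedgeChain (fun i => t i.succ) (M.ρ (t 0)⁻¹ u - u) := by
  rw [chainD_wedgeChain_eq_sum, ← Equiv.sum_comp Equiv.Perm.decomposeFin.symm,
    Fintype.sum_prod_type, Fin.sum_univ_succ, wedgeChain_apply]
  have h0 (p : Fin n) (σ : Equiv.Perm (Fin n)) :
      M.ρ (t (Equiv.Perm.decomposeFin.symm (p.succ, σ) 0))⁻¹ u - u = 0 := by
    rw [Equiv.Perm.decomposeFin_symm_apply_zero, hu, sub_self]
  rw [Finset.sum_eq_zero (s := (Finset.univ : Finset (Fin n))) fun p _ =>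
    Finset.sum_eq_zero fun σ _ => by rw [h0, single_zero, smul_zero], add_zero]
  simp only [Equiv.Perm.decomposeFin.symm_sign, Equiv.Perm.decomposeFin_symm_apply_zero,
    Equiv.Perm.decomposeFin_symm_apply_succ, Equiv.swap_self, Equiv.refl_apply, if_true, one_mul]

end CommChains

end RingHomology

namespace RingHomology

open Finsupp

/-! ### Homology with coefficients in `ℤ[A ⧸ H]` -/

section QuotRep

variable {A : Type} [AddCommGroup A]

/-- The translation action of `A` on `ℤ[A ⧸ H]`. -/
noncomputable def quotRep (H : Submodule ℤ A) :
    Representation ℤ (Multiplicative A) ((A ⧸ H) →₀ ℤ) where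
  toFun b := lmapDomain ℤ ℤ (fun x => H.mkQ b.toAdd + x)
  map_one' := by
    refine lhom_ext fun x c => ?_
    simp
  map_mul' b c := by
    refine lhom_ext fun x k => ?_
    simp [add_assoc]

theorem quotRep_single (H : Submodule ℤ A) (b : Multiplicative A) (x : A ⧸ H) (k : ℤ) :
    quotRep H b (single x k) = single (H.mkQ b.toAdd + x) k := by
  simp [quotRep]

/-- The chains homologous to a combination of the alternating chains
`wedgeChain (t_{i₁}, …, t_{i_q}) u` with `i₁ < ⋯ < i_q`. -/
noncomputable def wedgeSpan (M : Rep.{0} ℤ (Multiplicative A)) {k : ℕ} (t : Fin k → A) (u : M)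
    (q : ℕ) : AddSubgroup ((Fin q → Multiplicative A) →₀ M) :=
  AddSubgroup.closure (Set.range fun f : Fin q ↪o Fin k =>
    wedgeChain (fun i => Multiplicative.ofAdd (t (f i))) u) ⊔ (chainD M q).range

/-- Every cycle with coefficients in `M` is homologous to a combination of alternating chains
on `t` with coefficient `u`. -/
def IsWedgeSpanned (M : Rep.{0} ℤ (Multiplicative A)) {k : ℕ} (t : Fin k → A) (u : M) : Prop :=
  (∀ y, y ∈ wedgeSpan M t u 0) ∧ ∀ q y, chainD M q y = 0 → y ∈ wedgeSpan M t u (q + 1)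

/-! #### The free module -/

/-- The contracting homotopy of the chains with coefficients in `ℤ[A]`, written for the quotient
by a trivial subgroup. -/
noncomputable def barHomotopy (H : Submodule ℤ A) (q : ℕ) :
    ((Fin q → Multiplicative A) →₀ ((A ⧸ H) →₀ ℤ)) →+
      ((Fin (q + 1) → Multiplicative A) →₀ ((A ⧸ H) →₀ ℤ)) :=
  liftAddHom fun g => liftAddHom fun x =>
    (singleAddHom (Fin.cons (Multiplicative.ofAdd (-x.out)) g)).comp (singleAddHom (0 : A ⧸ H))

theorem barHomotopy_single (H : Submodule ℤ A) (q : ℕ) (g : Fin q → Multiplicative A)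
    (x : A ⧸ H) (k : ℤ) :
    barHomotopy H q (single g (single x k)) =
      single (Fin.cons (Multiplicative.ofAdd (-x.out)) g : Fin (q + 1) → Multiplicative A)
        (single 0 k) := by
  rw [barHomotopy, liftAddHom_apply_single, liftAddHom_apply_single]
  rfl

theorem contractNth_zero_cons {G : Type} [Mul G] {q : ℕ} (a : G) (g : Fin (q + 1) → G) :
    Fin.contractNth 0 (· * ·) (Fin.cons a g : Fin (q + 2) → G) =
      Fin.cons (a * g 0) (fun i => g i.succ) := by
  funext k
  refine Fin.cases ?_ (fun k => ?_) k
  · rw [Fin.contractNth_apply_of_eq _ _ _ _ rfl]; rfl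
  · rw [Fin.contractNth_apply_of_gt _ _ _ _ (by simp)]; rfl

theorem contractNth_succ_cons {G : Type} [Mul G] {q : ℕ} (j : Fin (q + 1)) (a : G)
    (g : Fin (q + 1) → G) :
    Fin.contractNth j.succ (· * ·) (Fin.cons a g : Fin (q + 2) → G) =
      Fin.cons a (Fin.contractNth j (· * ·) g) := by
  funext k
  refine Fin.cases ?_ (fun k => ?_) k
  · rw [Fin.contractNth_apply_of_lt _ _ _ _ (by simp)]; rfl
  · rw [Fin.cons_succ]
    rcases lt_trichotomy (k : ℕ) j with h | h | h
    · rw [Fin.contractNth_apply_of_lt _ _ _ _ h, Fin.contractNth_apply_of_lt _ _ _ _ (by simpa)]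
      rfl
    · rw [Fin.contractNth_apply_of_eq _ _ _ _ h, Fin.contractNth_apply_of_eq _ _ _ _ (by simpa)]
      rfl
    · rw [Fin.contractNth_apply_of_gt _ _ _ _ h, Fin.contractNth_apply_of_gt _ _ _ _ (by simpa)]
      rfl

theorem mk_out_eq (H : Submodule ℤ A) (x : A ⧸ H) : H.mkQ x.out = x := Quotient.out_eq x

theorem out_mk_of_eq_bot {H : Submodule ℤ A} (hH : H = ⊥) (a : A) : (H.mkQ a).out = a := by
  subst hH
  have h := (Submodule.Quotient.eq ⊥).1 (mk_out_eq ⊥ ((⊥ : Submodule ℤ A).mkQ a))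
  exact sub_eq_zero.1 ((Submodule.mem_bot ℤ).1 h)

theorem chainD_barHomotopy_succ {H : Submodule ℤ A} (hH : H = ⊥) (q : ℕ)
    (y : (Fin (q + 1) → Multiplicative A) →₀ ((A ⧸ H) →₀ ℤ)) :
    chainD (Rep.of (quotRep H)) (q + 1) (barHomotopy H (q + 1) y) =
      y - barHomotopy H q (chainD (Rep.of (quotRep H)) q y) := by
  suffices h : (chainD (Rep.of (quotRep H)) (q + 1)).comp (barHomotopy H (q + 1)) =
      AddMonoidHom.id _ - (barHomotopy H q).comp (chainD (Rep.of (quotRep H)) q) from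
    DFunLike.congr_fun h y
  refine addHom_ext' fun g => addHom_ext fun x k => ?_
  change chainD (Rep.of (quotRep H)) (q + 1) (barHomotopy H (q + 1) (single g (single x k))) =
    single g (single x k) -
      barHomotopy H q (chainD (Rep.of (quotRep H)) q (single g (single x k)))
  rw [barHomotopy_single, chainD_single, chainD_single, map_add, Fin.sum_univ_succ]
  simp only [map_sum, map_zsmul, contractNth_zero_cons, contractNth_succ_cons, Fin.cons_zero,
    Fin.cons_succ, barHomotopy_single, quotRep_single]
  have h1 : H.mkQ (Multiplicative.ofAdd (-x.out))⁻¹.toAdd + 0 = x := by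
    rw [add_zero, toAdd_inv, toAdd_ofAdd, neg_neg, mk_out_eq]
  have h2 : (H.mkQ (g 0)⁻¹.toAdd + x).out = - (g 0).toAdd + x.out := by
    conv_lhs => rw [← mk_out_eq H x, ← map_add, out_mk_of_eq_bot hH]
    rfl
  have h3 : Multiplicative.ofAdd (-(- (g 0).toAdd + x.out)) =
      Multiplicative.ofAdd (-x.out) * g 0 := by
    rw [neg_add, neg_neg, add_comm]; rfl
  rw [h1, h2, h3]
  simp only [Fin.val_succ, Fin.val_zero, pow_succ, pow_zero, mul_neg, mul_one, neg_smul,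
    neg_neg, one_smul, Finset.sum_neg_distrib]
  abel

theorem chainD_barHomotopy_zero {H : Submodule ℤ A}
    (y : (Fin 0 → Multiplicative A) →₀ ((A ⧸ H) →₀ ℤ)) :
    ∃ c : ℤ, chainD (Rep.of (quotRep H)) 0 (barHomotopy H 0 y) =
      y - single default (single 0 c) := by
  induction y using Finsupp.induction_linear with
  | zero => exact ⟨0, by simp⟩
  | add y z hy hz =>
    obtain ⟨c, hc⟩ := hy
    obtain ⟨c', hc'⟩ := hz
    exact ⟨c + c', by rw [map_add, map_add, hc, hc', single_add, single_add]; abel⟩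
  | single g m =>
    obtain rfl := Subsingleton.elim g default
    induction m using Finsupp.induction_linear with
    | zero => exact ⟨0, by simp⟩
    | add y z hy hz =>
      obtain ⟨c, hc⟩ := hy
      obtain ⟨c', hc'⟩ := hz
      exact ⟨c + c', by rw [single_add, map_add, map_add, hc, hc', single_add, single_add]; abel⟩
    | single x k =>
      refine ⟨k, ?_⟩
      rw [barHomotopy_single, chainD_single]
      simp only [quotRep_single, Fin.cons_zero]
      have h1 : H.mkQ (Multiplicative.ofAdd (-x.out))⁻¹.toAdd + 0 = x := by
        rw [add_zero, toAdd_inv, toAdd_ofAdd, neg_neg, mk_out_eq]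
      rw [h1, sub_eq_add_neg, Subsingleton.elim (fun i : Fin 0 => _) default]
      congr 1
      rw [Fin.sum_univ_succ, Fin.sum_univ_zero, add_zero,
        Subsingleton.elim (Fin.contractNth _ _ _) default]
      simp

theorem isWedgeSpanned_of_isEmpty (t : Fin 0 → A) :
    IsWedgeSpanned (Rep.of (quotRep (Submodule.span ℤ (Set.range t)))) t (single 0 1) := by
  have hH : Submodule.span ℤ (Set.range t) = ⊥ := by simp
  refine ⟨fun y => ?_, fun q y hy => ?_⟩
  · obtain ⟨c, hc⟩ := chainD_barHomotopy_zero y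
    have h : y = c • wedgeChain (fun i => Multiplicative.ofAdd
          (t ((OrderIso.refl (Fin 0)).toOrderEmbedding i)))
        (single 0 1) + chainD (Rep.of (quotRep _)) 0 (barHomotopy _ 0 y) := by
      rw [hc, wedgeChain_apply, Fintype.sum_unique, Subsingleton.elim (fun i : Fin 0 => _) default]
      simp
    rw [h]
    exact add_mem (AddSubgroup.mem_sup_left (zsmul_mem (AddSubgroup.subset_closure
      (Set.mem_range_self (OrderIso.refl (Fin 0)).toOrderEmbedding)) c))
      (AddSubgroup.mem_sup_right ⟨_, rfl⟩)
  · refine AddSubgroup.mem_sup_right ⟨barHomotopy _ (q + 1) y, ?_⟩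
    rw [chainD_barHomotopy_succ hH, hy, map_zero, sub_zero]

/-! #### Adjoining one generator -/

theorem map_mem_wedgeSpan {M N : Rep.{0} ℤ (Multiplicative A)} (p : M →+ N)
    (hp : ∀ g m, p (M.ρ g m) = N.ρ g (p m)) {k : ℕ} (t : Fin (k + 1) → A) (u : M) (q : ℕ)
    {y : (Fin q → Multiplicative A) →₀ M} (hy : y ∈ wedgeSpan M (fun i => t i.succ) u q) :
    mapRange.addMonoidHom p y ∈ wedgeSpan N t (p u) q := by
  suffices h : wedgeSpan M (fun i => t i.succ) u q ≤
      (wedgeSpan N t (p u) q).comap (mapRange.addMonoidHom p) from h hy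
  refine sup_le ((AddSubgroup.closure_le _).2 ?_) ?_
  · rintro _ ⟨f, rfl⟩
    refine AddSubgroup.mem_sup_left (AddSubgroup.subset_closure
      ⟨f.trans (Fin.succOrderEmb k), ?_⟩)
    exact (mapRange_wedgeChain p _ u).symm
  · rintro _ ⟨w, rfl⟩
    exact AddSubgroup.mem_sup_right ⟨mapRange.addMonoidHom p w, chainD_mapRange p hp q w⟩

/-- The strictly increasing sequence `0, f 0 + 1, f 1 + 1, …`. -/
def consOrderEmb {q k : ℕ} (f : Fin q ↪o Fin k) : Fin (q + 1) ↪o Fin (k + 1) :=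
  OrderEmbedding.ofStrictMono (Fin.cons 0 fun i => (f i).succ) fun i j => by
    refine Fin.cases (fun h => ?_) (fun i h => ?_) i
    · obtain ⟨j, rfl⟩ := Fin.exists_succ_eq.2 h.ne'
      exact Fin.succ_pos _
    · obtain ⟨j, rfl⟩ := Fin.exists_succ_eq.2 (h.trans_le' (Fin.zero_le _)).ne'
      exact Fin.succ_lt_succ_iff.2 (f.lt_iff_lt.2 (Fin.succ_lt_succ_iff.1 h))

/-- Prepending a letter `t₀` to an alternating chain whose letters fix `u` produces a chain whose
boundary is the image of the given one under `t₀⁻¹ - 1`. -/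
theorem exists_chainD_eq_mapRange (M : Rep.{0} ℤ (Multiplicative A)) (D : M →+ M) {k : ℕ}
    (t : Fin (k + 1) → A) (u : M) (hD : ∀ m, D m = M.ρ (Multiplicative.ofAdd (t 0))⁻¹ m - m)
    (hu : ∀ i : Fin k, M.ρ (Multiplicative.ofAdd (t i.succ))⁻¹ u = u) (q : ℕ)
    {v : (Fin q → Multiplicative A) →₀ M}
    (hv : v ∈ AddSubgroup.closure (Set.range fun f : Fin q ↪o Fin k =>
      wedgeChain (fun i => Multiplicative.ofAdd (t (f i).succ)) u)) :
    ∃ V ∈ AddSubgroup.closure (Set.range fun f : Fin (q + 1) ↪o Fin (k + 1) =>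
      wedgeChain (fun i => Multiplicative.ofAdd (t (f i))) u),
      chainD M q V = mapRange.addMonoidHom D v := by
  induction hv using AddSubgroup.closure_induction with
  | mem v hv =>
    obtain ⟨f, rfl⟩ := hv
    refine ⟨_, AddSubgroup.subset_closure ⟨consOrderEmb f, rfl⟩, ?_⟩
    beta_reduce
    rw [chainD_wedgeChain_of_forall_succ_fixed M _ u fun i => hu (f i), mapRange_wedgeChain, hD]
    rfl
  | zero => exact ⟨0, zero_mem _, by rw [map_zero, map_zero]⟩
  | add v w _ _ h1 h2 =>
    obtain ⟨V, hV, h1⟩ := h1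
    obtain ⟨W, hW, h2⟩ := h2
    exact ⟨V + W, add_mem hV hW, by rw [map_add, map_add, h1, h2]⟩
  | neg v _ h =>
    obtain ⟨V, hV, h⟩ := h
    exact ⟨-V, neg_mem hV, by rw [map_neg, map_neg, h]⟩

theorem rho_sub_comm {k G : Type} [CommRing k] [CommGroup G] (M : Rep.{0} k G) (a b : G) (v : M) :
    M.ρ a (M.ρ b v) - M.ρ b v = M.ρ b (M.ρ a v - v) := by
  rw [map_sub, ← Module.End.mul_apply, ← Module.End.mul_apply, ← map_mul, ← map_mul, mul_comm]

/-- If `t₀⁻¹ - 1` is injective on `M` with cokernel `N`, then a spanning family of wedges for `M`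
is turned into one for `N` by adjoining the letter `t₀`. This is a diagram chase in the long exact
sequence of `0 → M → M → N → 0`, done on chains. -/
theorem IsWedgeSpanned.adjoin {M N : Rep.{0} ℤ (Multiplicative A)} (p : M →+ N) (D : M →+ M)
    (hp : ∀ g m, p (M.ρ g m) = N.ρ g (p m)) {k : ℕ} (t : Fin (k + 1) → A) (u : M)
    (hD : ∀ m, D m = M.ρ (Multiplicative.ofAdd (t 0))⁻¹ m - m)
    (hu : ∀ i : Fin k, M.ρ (Multiplicative.ofAdd (t i.succ))⁻¹ u = u)
    (hpsurj : Function.Surjective p) (hDinj : Function.Injective D)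
    (hpD : ∀ m, p m = 0 ↔ ∃ m', D m' = m)
    (hM : IsWedgeSpanned M (fun i => t i.succ) u) : IsWedgeSpanned N t (p u) := by
  have hDρ (g : Multiplicative A) (m : M) : D (M.ρ g m) = M.ρ g (D m) := by
    rw [hD, hD]
    exact rho_sub_comm M _ g m
  have hsurj (q : ℕ) : Function.Surjective
      (mapRange.addMonoidHom p : ((Fin q → Multiplicative A) →₀ M) →+ _) :=
    mapRange_surjective p (map_zero p) hpsurj
  have hinj (q : ℕ) : Function.Injective
      (mapRange.addMonoidHom D : ((Fin q → Multiplicative A) →₀ M) →+ _) :=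
    mapRange_injective D (map_zero D) hDinj
  have hcomp (q : ℕ) (x : (Fin q → Multiplicative A) →₀ M) :
      mapRange.addMonoidHom p (mapRange.addMonoidHom D x) = 0 :=
    Finsupp.ext fun g => (hpD _).2 ⟨_, rfl⟩
  have hexact (q : ℕ) (x : (Fin q → Multiplicative A) →₀ M)
      (hx : mapRange.addMonoidHom p x = 0) : ∃ x', mapRange.addMonoidHom D x' = x := by
    induction x using Finsupp.induction with
    | zero => exact ⟨0, map_zero _⟩
    | single_add g m x hg hm ih =>
      have h1 : p m = 0 := by
        have := DFunLike.congr_fun hx g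
        simpa [notMem_support_iff.1 hg] using this
      obtain ⟨m', rfl⟩ := (hpD m).1 h1
      obtain ⟨x', rfl⟩ := ih (by
        rwa [map_add, mapRange.addMonoidHom_apply, mapRange_single, h1, single_zero,
          zero_add] at hx)
      exact ⟨single g m' + x', by
        rw [map_add, mapRange.addMonoidHom_apply, mapRange_single]⟩
  refine ⟨fun y => ?_, fun q y hy => ?_⟩
  · obtain ⟨y, rfl⟩ := hsurj 0 y
    exact map_mem_wedgeSpan p hp t u 0 (hM.1 y)
  · obtain ⟨y, rfl⟩ := hsurj (q + 1) y
    rw [chainD_mapRange p hp] at hy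
    obtain ⟨x, hx⟩ := hexact q _ hy
    have hx' : x ∈ wedgeSpan M (fun i => t i.succ) u q := by
      cases q with
      | zero => exact hM.1 x
      | succ q =>
        refine hM.2 q x (hinj q ?_)
        rw [← chainD_mapRange D hDρ, hx, chainD_chainD, map_zero]
    obtain ⟨v, hv, _, ⟨w, rfl⟩, rfl⟩ := AddSubgroup.mem_sup.1 hx'
    obtain ⟨V, hV, hVv⟩ := exists_chainD_eq_mapRange M D t u hD hu q hv
    have h1 : y - V - mapRange.addMonoidHom D w ∈ wedgeSpan M (fun i => t i.succ) u (q + 1) := by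
      refine hM.2 q _ ?_
      rw [map_sub, map_sub, hVv, chainD_mapRange D hDρ, ← hx, map_add]
      abel
    have h2 := map_mem_wedgeSpan p hp t u (q + 1) h1
    rw [map_sub, map_sub, hcomp, sub_zero] at h2
    rw [← sub_add_cancel (mapRange.addMonoidHom p y) (mapRange.addMonoidHom p V)]
    refine add_mem h2 (AddSubgroup.mem_sup_left ?_)
    have h3 := AddSubgroup.mem_map_of_mem (mapRange.addMonoidHom p) hV
    rw [AddMonoidHom.map_closure, ← Set.range_comp] at h3
    convert h3 using 4 with f
    exact (mapRange_wedgeChain p _ u).symm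

/-! #### Cosets of a free subgroup -/

/-- The projection `ℤ[A ⧸ H] → ℤ[A ⧸ H']` for `H ≤ H'`. -/
noncomputable def quotProj {H H' : Submodule ℤ A} (h : H ≤ H') :
    ((A ⧸ H) →₀ ℤ) →+ ((A ⧸ H') →₀ ℤ) :=
  mapDomain.addMonoidHom (Submodule.factor h)

theorem quotProj_single {H H' : Submodule ℤ A} (h : H ≤ H') (x : A ⧸ H) (k : ℤ) :
    quotProj h (single x k) = single (Submodule.factor h x) k := mapDomain_single

theorem quotRep_apply (H : Submodule ℤ A) (b : Multiplicative A) (m : (A ⧸ H) →₀ ℤ) (x : A ⧸ H) :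
    quotRep H b m x = m (x - H.mkQ b.toAdd) := by
  have h := mapDomain_apply (add_right_injective (H.mkQ b.toAdd)) m (x - H.mkQ b.toAdd)
  rwa [add_sub_cancel] at h

/-- The endomorphism `t⁻¹ - 1` of `ℤ[A ⧸ H]`. -/
noncomputable def quotDiff (H : Submodule ℤ A) (t : A) : ((A ⧸ H) →₀ ℤ) →+ ((A ⧸ H) →₀ ℤ) :=
  (quotRep H (Multiplicative.ofAdd t)⁻¹).toAddMonoidHom - AddMonoidHom.id _

theorem quotDiff_apply (H : Submodule ℤ A) (t : A) (m : (A ⧸ H) →₀ ℤ) :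
    quotDiff H t m = quotRep H (Multiplicative.ofAdd t)⁻¹ m - m := rfl

/-- A finitely supported function which is periodic under an element of infinite order is zero. -/
theorem quotDiff_injective {H : Submodule ℤ A} {t : A} (ht : ∀ n : ℤ, n • t ∈ H → n = 0) :
    Function.Injective (quotDiff H t) := by
  refine (injective_iff_map_eq_zero _).2 fun m hm => Finsupp.ext fun x => ?_
  by_contra hx
  have h1 (y : A ⧸ H) : m (y + H.mkQ t) = m y := by
    have := DFunLike.congr_fun hm y
    rw [quotDiff_apply, Finsupp.sub_apply, quotRep_apply, Finsupp.zero_apply, sub_eq_zero] at this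
    rw [← this]
    congr 1
    rw [toAdd_inv, toAdd_ofAdd, map_neg, sub_neg_eq_add]
  have h2 (n : ℕ) : m (x + H.mkQ ((n : ℤ) • t)) = m x := by
    induction n with
    | zero => simp
    | succ n ih => rw [Nat.cast_succ, add_smul, one_smul, map_add H.mkQ, ← add_assoc x, h1, ih]
  refine Set.infinite_of_injective_forall_mem (s := (m.support : Set (A ⧸ H)))
    (f := fun n : ℕ => x + H.mkQ ((n : ℤ) • t)) (fun n n' h => ?_) (fun n => ?_)
    m.support.finite_toSet
  · have h3 := (Submodule.Quotient.eq H).1 (add_left_cancel h)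
    rw [← sub_smul] at h3
    exact_mod_cast sub_eq_zero.1 (ht _ h3)
  · rw [Finset.mem_coe, mem_support_iff, h2]
    exact hx

theorem quotProj_eq_zero_iff {H H' : Submodule ℤ A} (h : H ≤ H') {t : A} (ht : t ∈ H')
    (hH' : ∀ x ∈ H', ∃ n : ℤ, x - n • t ∈ H) (m : (A ⧸ H) →₀ ℤ) :
    quotProj h m = 0 ↔ ∃ m', quotDiff H t m' = m := by
  constructor
  · intro hm
    have hstep (x : A ⧸ H) (k : ℤ) :
        single x k - single (x + H.mkQ t) k ∈ (quotDiff H t).range := by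
      refine ⟨single (x + H.mkQ t) k, ?_⟩
      rw [quotDiff_apply, quotRep_single, toAdd_inv, toAdd_ofAdd, map_neg, add_comm x,
        neg_add_cancel_left]
    have hmult (x : A ⧸ H) (k : ℤ) (n : ℤ) :
        single x k - single (x + H.mkQ (n • t)) k ∈ (quotDiff H t).range := by
      induction n using Int.induction_on with
      | zero => simp
      | succ n ih =>
        have := add_mem ih (hstep (x + H.mkQ ((n : ℤ) • t)) k)
        rwa [sub_add_sub_cancel, add_assoc, ← map_add, ← add_one_zsmul] at this
      | pred n ih =>
        have := sub_mem ih (hstep (x + H.mkQ ((-(n : ℤ) - 1) • t)) k)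
        rw [add_assoc, ← map_add, ← add_one_zsmul, sub_add_cancel] at this
        convert this using 1
        abel
    let σ : A ⧸ H' → A ⧸ H := Function.surjInv (Submodule.factor_surjective h)
    have hσ (m : (A ⧸ H) →₀ ℤ) :
        m - mapDomain.addMonoidHom σ (quotProj h m) ∈ (quotDiff H t).range := by
      induction m using Finsupp.induction_linear with
      | zero => simp
      | add m m' h1 h2 =>
        have := add_mem h1 h2
        rw [map_add, map_add]
        convert this using 1
        abel
      | single x k =>
        rw [quotProj_single, mapDomain.addMonoidHom_apply, mapDomain_single]
        have h1 : Submodule.factor h (σ (Submodule.factor h x)) = Submodule.factor h x :=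
          Function.surjInv_eq _ _
        generalize σ (Submodule.factor h x) = y at h1 ⊢
        obtain ⟨x, rfl⟩ := H.mkQ_surjective x
        obtain ⟨y, rfl⟩ := H.mkQ_surjective y
        obtain ⟨n, hn⟩ := hH' _ ((Submodule.Quotient.eq H').1 h1)
        have h2 : H.mkQ y = H.mkQ x + H.mkQ (n • t) := by
          rw [← map_add]
          refine (Submodule.Quotient.eq H).2 ?_
          rwa [sub_add_eq_sub_sub]
        rw [h2]
        exact hmult _ _ _
    have := hσ m
    rwa [hm, map_zero, sub_zero] at this
  · rintro ⟨m', rfl⟩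
    induction m' using Finsupp.induction_linear with
    | zero => simp
    | add m m' h1 h2 => rw [map_add, map_add, h1, h2, add_zero]
    | single x k =>
      rw [quotDiff_apply, quotRep_single, map_sub, quotProj_single, quotProj_single, map_add,
        toAdd_inv, toAdd_ofAdd]
      have : Submodule.factor h (H.mkQ (-t)) = 0 :=
        (Submodule.Quotient.mk_eq_zero H').2 (neg_mem ht)
      rw [this, zero_add, sub_self]

/-- For linearly independent `t₁, …, t_k ∈ A` spanning `H`, the homology of `A` with coefficients
in `ℤ[A ⧸ H]` is spanned by the wedges of the `t_i`. -/
theorem isWedgeSpanned_quotRep {k : ℕ} (t : Fin k → A) (ht : LinearIndependent ℤ t) :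
    IsWedgeSpanned (Rep.of (quotRep (Submodule.span ℤ (Set.range t)))) t (single 0 1) := by
  induction k with
  | zero => exact isWedgeSpanned_of_isEmpty t
  | succ k ih =>
    set H := Submodule.span ℤ (Set.range fun i : Fin k => t i.succ) with hH
    set H' := Submodule.span ℤ (Set.range t) with hH'
    have hle : H ≤ H' := Submodule.span_mono (by rintro _ ⟨i, rfl⟩; exact ⟨_, rfl⟩)
    have ht0 : t 0 ∈ H' := Submodule.subset_span ⟨0, rfl⟩
    have hsplit : ∀ x ∈ H', ∃ n : ℤ, x - n • t 0 ∈ H := by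
      intro x hx
      have : Set.range t = insert (t 0) (Set.range fun i : Fin k => t i.succ) := by
        rw [← Fin.range_cons]
        congr 1
        exact (Fin.cons_self_tail t).symm
      rw [hH', this] at hx
      obtain ⟨n, z, hz, rfl⟩ := Submodule.mem_span_insert.1 hx
      exact ⟨n, by rwa [add_sub_cancel_left]⟩
    have hindep : ∀ n : ℤ, n • t 0 ∈ H → n = 0 := by
      intro n hn
      obtain ⟨c, hc⟩ := (Submodule.mem_span_range_iff_exists_fun ℤ).1 hn
      have := Fintype.linearIndependent_iff.1 ht (Fin.cons (-n) c) (by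
        rw [Fin.sum_univ_succ]
        simp [hc]) 0
      simpa using this
    have hM := ih (fun i => t i.succ) (ht.comp _ (Fin.succ_injective k))
    have key := IsWedgeSpanned.adjoin (M := Rep.of (quotRep H)) (N := Rep.of (quotRep H'))
      (quotProj hle) (quotDiff H (t 0)) ?_ t (single 0 1) (fun m => rfl) ?_ ?_
      (quotDiff_injective hindep) (quotProj_eq_zero_iff hle ht0 hsplit) hM
    · rwa [quotProj_single, map_zero] at key
    · intro g m
      change quotProj hle (quotRep H g m) = quotRep H' g (quotProj hle m)
      induction m using Finsupp.induction_linear with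
      | zero => simp
      | add m m' h1 h2 => rw [map_add, map_add, map_add, map_add, h1, h2]
      | single x k =>
        rw [quotRep_single, quotProj_single, quotProj_single, quotRep_single, map_add]
        rfl
    · intro i
      change quotRep H _ (single 0 1) = _
      rw [quotRep_single, add_zero]
      congr 1
      exact (Submodule.Quotient.mk_eq_zero H).2 (neg_mem (Submodule.subset_span ⟨i, rfl⟩))
    · exact mapDomain_surjective (Submodule.factor_surjective hle)

end QuotRep

end RingHomology

namespace RingHomology

/-! ### The profinite group `R̄` -/

section Profinite

variable {R : Type} [Ring R] {S : Submonoid R}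

/-- The constructible subgroup `σ_s C`. -/
def Constructible.image (s : S) (C : Constructible S) : Constructible S :=
  ⟨C.1.map (AddMonoidHom.mulLeft (s : R)), .image s C.2⟩

/-- The constructible subgroup `s R`. -/
def principal (s : S) : Constructible S := Constructible.image s ⟨⊤, .top⟩

theorem mem_principal {s : S} {r : R} : r ∈ (principal s).1 ↔ ∃ r' : R, (s : R) * r' = r := by
  simp [principal, Constructible.image]

theorem mem_image_iff {s : S} {C : Constructible S} {r : R} :
    r ∈ (C.image s).1 ↔ ∃ r' ∈ C.1, (s : R) * r' = r := by
  simp [Constructible.image]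

namespace Completion

/-- The map `R ⧸ C → R ⧸ σ_s C` induced by `σ_s`. -/
def mulImage (s : S) (C : Constructible S) : R ⧸ C.1 →+ R ⧸ (C.image s).1 :=
  QuotientAddGroup.map _ _ (AddMonoidHom.mulLeft (s : R)) (AddSubgroup.le_comap_map _ _)

theorem proj_surjective_of (C : Constructible S) (x : Completion S) :
    ∃ r : R, proj C x = (r : R ⧸ C.1) := by
  obtain ⟨r, hr⟩ := QuotientAddGroup.mk_surjective (proj C x)
  exact ⟨r, hr.symm⟩

theorem proj_principal_smul (s : S) (x : Completion S) : proj (principal s) (s • x) = 0 := by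
  rw [proj_smul]
  obtain ⟨r, hr⟩ := proj_surjective_of ((principal s).preimage s) x
  rw [hr]
  exact (QuotientAddGroup.eq_zero_iff _).2 (mem_principal.2 ⟨r, rfl⟩)

variable [hS : IsAdmissible S]

theorem mulImage_injective (s : S) (C : Constructible S) : Function.Injective (mulImage s C) := by
  refine (injective_iff_map_eq_zero _).2 fun x hx => ?_
  obtain ⟨r, rfl⟩ := QuotientAddGroup.mk_surjective x
  obtain ⟨r', hr', h⟩ := mem_image_iff.1 ((QuotientAddGroup.eq_zero_iff _).1 hx)
  obtain rfl : r' = r := hS.isLeftRegular s s.2 h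
  exact (QuotientAddGroup.eq_zero_iff _).2 hr'

/-- The image of `σ_s` on `R̄` is the kernel of the projection to `R ⧸ s R`. -/
theorem exists_smul_eq_iff (s : S) (x : Completion S) :
    (∃ y : Completion S, s • y = x) ↔ proj (principal s) x = 0 := by
  refine ⟨?_, fun hx => ?_⟩
  · rintro ⟨y, rfl⟩
    exact proj_principal_smul s y
  · have h1 (C : Constructible S) : ∃ z, mulImage s C z = proj (C.image s) x := by
      obtain ⟨r, hr⟩ := proj_surjective_of (C.image s) x
      have hle : (C.image s).1 ≤ (principal s).1 := AddSubgroup.map_mono le_top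
      rw [← map_proj x _ _ hle, hr] at hx
      obtain ⟨r', rfl⟩ := mem_principal.1 ((QuotientAddGroup.eq_zero_iff _).1 hx)
      exact ⟨(r' : R ⧸ C.1), hr.symm⟩
    choose z hz using h1
    have hmem : z ∈ completionSubgroup S := fun C D h => mulImage_injective s D <| by
      have hle : (C.image s).1 ≤ (D.image s).1 := AddSubgroup.map_mono h
      rw [hz D, ← map_proj x _ _ hle, ← hz C]
      obtain ⟨r, hr⟩ := QuotientAddGroup.mk_surjective (z C)
      rw [← hr]
      rfl
    let y : Completion S := ⟨z, hmem⟩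
    have hy (C : Constructible S) : proj C y = z C := rfl
    refine ⟨y, ext fun C => ?_⟩
    have hle : ((C.preimage s).image s).1 ≤ C.1 := AddSubgroup.map_comap_le _ _
    rw [proj_smul, ← map_proj x _ _ hle, ← hz, hy]
    obtain ⟨r, hr⟩ := QuotientAddGroup.mk_surjective (z (C.preimage s))
    rw [← hr]
    rfl

theorem smul_injective (s : S) : Function.Injective (fun x : Completion S => s • x) := by
  intro x y hxy
  refine ext fun C => mulImage_injective s C ?_
  have h (x : Completion S) : proj (C.image s) (s • x) = mulImage s C (proj C x) := by
    have hle : C.1 ≤ ((C.image s).preimage s).1 := AddSubgroup.le_comap_map _ _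
    rw [proj_smul, ← map_proj x C _ hle]
    obtain ⟨r, hr⟩ := proj_surjective_of C x
    rw [hr]
    rfl
  rw [← h, ← h]
  exact congrArg (proj _) hxy

variable [Module.Finite ℤ R] [Module.Free ℤ R]

theorem exists_nsmul_mem_principal (s : S) : ∃ n : ℕ, 0 < n ∧ ∀ r : R, n • r ∈ (principal s).1 := by
  have hinj : Function.Injective (LinearMap.mulLeft ℤ (s : R)) := hS.isLeftRegular s s.2
  have hfin : Finite (R ⧸ LinearMap.range (LinearMap.mulLeft ℤ (s : R))) :=
    Submodule.finiteQuotientOfFreeOfRankEq _ (LinearMap.finrank_range_of_inj hinj)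
  refine ⟨Nat.card (R ⧸ LinearMap.range (LinearMap.mulLeft ℤ (s : R))), Nat.card_pos,
    fun r => mem_principal.2 ?_⟩
  have h : Nat.card (R ⧸ LinearMap.range (LinearMap.mulLeft ℤ (s : R))) •
      (LinearMap.range (LinearMap.mulLeft ℤ (s : R))).mkQ r = 0 := card_nsmul_eq_zero'
  rw [← map_nsmul] at h
  exact (Submodule.Quotient.mk_eq_zero _).1 h

/-- Every constructible subgroup contains `n R` for some positive integer `n`. -/
theorem exists_nsmul_mem (C : Constructible S) : ∃ n : ℕ, 0 < n ∧ ∀ r : R, n • r ∈ C.1 := by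
  obtain ⟨C, hC⟩ := C
  induction hC with
  | top => exact ⟨1, one_pos, fun r => AddSubgroup.mem_top _⟩
  | image s hC ih =>
    obtain ⟨n, hn, h⟩ := ih
    obtain ⟨m, hm, h'⟩ := exists_nsmul_mem_principal s
    refine ⟨n * m, Nat.mul_pos hn hm, fun r => ?_⟩
    obtain ⟨r', hr'⟩ := mem_principal.1 (h' r)
    refine ⟨n • r', h r', ?_⟩
    change (s : R) * (n • r') = _
    rw [mul_smul_comm, hr', mul_smul]
  | preimage s hC ih =>
    obtain ⟨n, hn, h⟩ := ih
    refine ⟨n, hn, fun r => ?_⟩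
    refine AddSubgroup.mem_comap.2 ?_
    rw [map_nsmul]
    exact h _

theorem finite_quotient (C : Constructible S) : Finite (R ⧸ C.1) := by
  obtain ⟨n, hn, h⟩ := exists_nsmul_mem C
  have : Module.Finite ℤ (R ⧸ AddSubgroup.toIntSubmodule C.1) := inferInstance
  refine Module.finite_of_fg_torsion (R ⧸ AddSubgroup.toIntSubmodule C.1) ?_
  intro x
  obtain ⟨r, rfl⟩ := Submodule.mkQ_surjective _ x
  refine ⟨⟨n, mem_nonZeroDivisors_of_ne_zero (by exact_mod_cast hn.ne')⟩, ?_⟩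
  refine (Submodule.Quotient.mk_eq_zero (AddSubgroup.toIntSubmodule C.1)).2 ?_
  have := h r
  rwa [← natCast_zsmul] at this

instance : CompactSpace (Completion S) := by
  let (C : Constructible S) : TopologicalSpace (R ⧸ C.1) := ⊥
  have (C : Constructible S) : DiscreteTopology (R ⧸ C.1) := ⟨rfl⟩
  have (C : Constructible S) : Finite (R ⧸ C.1) := finite_quotient C
  have hclosed : IsClosed (completionSubgroup S : Set (∀ C : Constructible S, R ⧸ C.1)) := by
    have : (completionSubgroup S : Set (∀ C : Constructible S, R ⧸ C.1)) =
        ⋂ (C : Constructible S) (D : Constructible S) (h : C.1 ≤ D.1),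
          {x | QuotientAddGroup.map C.1 D.1 (AddMonoidHom.id R) h (x C) = x D} := by
      ext x
      simp only [Set.mem_iInter]
      rfl
    rw [this]
    refine isClosed_iInter fun C => isClosed_iInter fun D => isClosed_iInter fun h => ?_
    exact isClosed_eq (continuous_of_discreteTopology.comp (continuous_apply C))
      (continuous_apply D)
  exact isCompact_iff_compactSpace.1 hclosed.isCompact

/-- The subgroups `n R̄` shrink to `0`. -/
theorem exists_forall_add_nsmul_mem {V : Set (Completion S)}
    (hV : IsOpen V) {y : Completion S} (hy : y ∈ V) :
    ∃ n : ℕ, 0 < n ∧ ∀ z : Completion S, y + n • z ∈ V := by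
  let (C : Constructible S) : TopologicalSpace (R ⧸ C.1) := ⊥
  have (C : Constructible S) : DiscreteTopology (R ⧸ C.1) := ⟨rfl⟩
  have h1 : V ∈ nhds y := hV.mem_nhds hy
  have h2 : nhds y = Filter.comap (fun x : Completion S => fun C => proj C x)
      (nhds fun C => proj C y) := nhds_induced _ _
  rw [h2, nhds_pi, Filter.mem_comap] at h1
  obtain ⟨W, hW, hWV⟩ := h1
  obtain ⟨I, hI, t, ht, htW⟩ := Filter.mem_pi.1 hW
  choose m hm hmC using exists_nsmul_mem (S := S)
  refine ⟨∏ C ∈ hI.toFinset, m C, Finset.prod_pos fun C _ => hm C, fun z => hWV (htW ?_)⟩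
  intro C hC
  have h3 : proj C ((∏ C ∈ hI.toFinset, m C) • z) = 0 := by
    obtain ⟨k, hk⟩ := Finset.dvd_prod_of_mem m (hI.mem_toFinset.2 hC)
    obtain ⟨r, hr⟩ := proj_surjective_of C z
    rw [hk, mul_comm, mul_smul, map_nsmul, map_nsmul, hr]
    have h4 : m C • (r : R ⧸ C.1) = 0 := (QuotientAddGroup.eq_zero_iff _).2 (hmC C r)
    rw [h4, smul_zero]
  beta_reduce
  rw [map_add, h3, add_zero]
  exact mem_of_mem_nhds (ht C)

end Completion

end Profinite

end RingHomology

namespace RingHomology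

/-! ### The locally compact group `𝒜̄` -/

section LocallyCompact

variable {R : Type} [Ring R] {S : Submonoid R} [Module.Finite ℤ R] [hS : IsAdmissible S]
  [Module.Free ℤ R]

namespace QuotGroup

/-- The inclusion `S → 𝒮`. -/
noncomputable def num (s : S) : QuotGroup S := s /ₒ (1 : (⊤ : Submonoid S))

theorem num_mul (s t : S) : num (s * t) = num s * num t :=
  map_mul (OreLocalization.numeratorHom (R := S) (S := (⊤ : Submonoid S))) s t

theorem num_smul_oreDiv_one (s : S) (y : Completion S) :
    num s • (y /ₒ 1 : FullCompletion S) = (s • y) /ₒ 1 := by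
  rw [num, OreLocalization.oreDiv_smul_char s y 1 1 s 1 (by simp)]
  simp

theorem inv_num_smul_oreDiv_one (s : S) (y : Completion S) :
    (num s)⁻¹ • (y /ₒ 1 : FullCompletion S) = y /ₒ (⟨s, trivial⟩ : (⊤ : Submonoid S)) := by
  rw [inv_smul_eq_iff, num,
    OreLocalization.oreDiv_smul_char s y 1 (⟨s, trivial⟩ : (⊤ : Submonoid S)) 1 1 rfl]
  simp

theorem coe_embed_num (s : S) : (embed S (num s) : RatAlg R) = 1 ⊗ₜ (s : R) := by
  rw [num, embed_oreDiv]
  simp [coe_unitsOf]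

theorem eq_inv_num_mul_num (a : QuotGroup S) : ∃ s t : S, a = (num t)⁻¹ * num s := by
  induction a using OreLocalization.ind with
  | _ s t =>
    refine ⟨s, t.1, ?_⟩
    rw [eq_inv_mul_iff_mul_eq]
    exact OreLocalization.mul_cancel (S := (⊤ : Submonoid S)) (s := t) (t := 1)

/-- Left reversibility of `S` gives common right multiples in `𝒮`. -/
theorem exists_mul_num_eq (a b : QuotGroup S) : ∃ s t : S, a * num s = b * num t := by
  obtain ⟨p, q, h⟩ := eq_inv_num_mul_num (a⁻¹ * b)
  obtain ⟨t, s, hst⟩ := hS.left_reversible p q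
  refine ⟨s, t, ?_⟩
  rw [inv_mul_eq_iff_eq_mul] at h
  rw [h, mul_assoc, mul_assoc, ← num_mul, hst, num_mul, inv_mul_cancel_left]

/-- The positive integer `n` as an element of `𝒮`. -/
noncomputable def ofNat (n : ℕ) (hn : 0 < n) : QuotGroup S :=
  num (FullCompletion.posInt S n hn).1

theorem ofNat_mul (m n : ℕ) (hm : 0 < m) (hn : 0 < n) :
    (ofNat (m * n) (Nat.mul_pos hm hn) : QuotGroup S) = ofNat m hm * ofNat n hn := by
  rw [ofNat, ofNat, ofNat, ← num_mul]
  congr 1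
  exact Subtype.ext (Nat.cast_mul m n)

theorem ofNat_smul_oreDiv_one (n : ℕ) (hn : 0 < n) (y : Completion S) :
    (ofNat n hn : QuotGroup S) • (y /ₒ 1 : FullCompletion S) = (n • y) /ₒ 1 := by
  rw [ofNat, num_smul_oreDiv_one, FullCompletion.posInt_smul]

theorem coe_embed_ofNat (n : ℕ) (hn : 0 < n) :
    (embed S (ofNat n hn : QuotGroup S) : RatAlg R) = n := by
  rw [ofNat, coe_embed_num]
  exact map_natCast (Algebra.TensorProduct.includeRight (R := ℤ) (A := ℚ) (B := R)) n

end QuotGroup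

open QuotGroup

namespace FullCompletion

theorem exists_eq_inv_num_smul (x : FullCompletion S) :
    ∃ (s : S) (y : Completion S), x = (num s)⁻¹ • (y /ₒ 1 : FullCompletion S) := by
  induction x using OreLocalization.ind with
  | _ y s => exact ⟨s.1, y, (inv_num_smul_oreDiv_one s.1 y).symm⟩

variable (S) in
/-- The inclusion `ι_1 : R̄ → 𝒜̄`. -/
noncomputable def incl : Completion S →+ FullCompletion S where
  toFun y := y /ₒ 1
  map_zero' := by simp
  map_add' x y := (OreLocalization.add_oreDiv).symm

theorem incl_apply (y : Completion S) : incl S y = y /ₒ 1 := rfl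

theorem oreDiv_eq_incl_iff {x y : Completion S} {s : (⊤ : Submonoid S)} :
    (x /ₒ s : FullCompletion S) = incl S y ↔ x = s.1 • y := by
  rw [incl_apply, oreDiv_eq_iff']
  constructor
  · rintro ⟨p, q, h1, h2⟩
    have h1 : p * s.1 = q := by simpa using h1
    rw [← h1, mul_smul] at h2
    exact Completion.smul_injective p h2
  · rintro rfl
    exact ⟨1, s.1, by simp, by simp⟩

theorem incl_injective : Function.Injective (incl S) := fun x y h => by
  simpa using oreDiv_eq_incl_iff (s := 1).1 h

variable (S) in
/-- The compact open subgroup `R̄ = ι_1(R̄)` of `𝒜̄`. -/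
noncomputable def unitBall : AddSubgroup (FullCompletion S) := (incl S).range

theorem oreDiv_mem_unitBall {x : Completion S} {s : (⊤ : Submonoid S)} :
    (x /ₒ s : FullCompletion S) ∈ unitBall S ↔ Completion.proj (principal s.1) x = 0 := by
  rw [← Completion.exists_smul_eq_iff]
  exact exists_congr fun y => eq_comm.trans (oreDiv_eq_incl_iff.trans eq_comm)

theorem isOpen_unitBall : IsOpen (unitBall S : Set (FullCompletion S)) := by
  refine isOpen_iSup_iff.2 fun s => isOpen_coinduced.2 ?_
  let (C : Constructible S) : TopologicalSpace (R ⧸ C.1) := ⊥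
  have (C : Constructible S) : DiscreteTopology (R ⧸ C.1) := ⟨rfl⟩
  have h := (isOpen_discrete {(0 : R ⧸ (principal s.1).1)}).preimage
    (Completion.continuous_proj (principal s.1))
  convert h using 1
  ext x
  exact oreDiv_mem_unitBall

theorem isCompact_unitBall : IsCompact (unitBall S : Set (FullCompletion S)) :=
  isCompact_range (continuous_oreDiv 1)

theorem isClosed_unitBall : IsClosed (unitBall S : Set (FullCompletion S)) := by
  rw [← isOpen_compl_iff, isOpen_iff_forall_mem_open]
  intro x hx
  refine ⟨(translate x).symm ⁻¹' unitBall S, fun y hy hy' => hx ?_,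
    isOpen_unitBall.preimage (translate x).symm.continuous, ?_⟩
  · have hy : y + -x ∈ unitBall S := hy
    have := sub_mem hy' hy
    rwa [← sub_eq_add_neg, sub_sub_cancel] at this
  · change x + -x ∈ unitBall S
    rw [add_neg_cancel]
    exact zero_mem _

theorem num_smul_mem_unitBall (s : S) {x : FullCompletion S} (hx : x ∈ unitBall S) :
    num s • x ∈ unitBall S := by
  obtain ⟨y, rfl⟩ := hx
  exact ⟨s • y, (num_smul_oreDiv_one s y).symm⟩

theorem ofRat_one_tmul (r : R) : ofRat S (1 ⊗ₜ r) = incl S (Completion.of r) := by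
  have h := ofRat_tmul (S := S) 1 1 one_pos r
  rw [one_smul, Int.cast_one, Nat.cast_one, div_one] at h
  rw [h, incl_apply]
  congr 1
  exact Subtype.ext (Subtype.ext (Nat.cast_one))

omit hS [Module.Finite ℤ R] [Module.Free ℤ R] in
theorem exists_nsmul_eq_one_tmul (x : RatAlg R) : ∃ n : ℕ, 0 < n ∧ ∃ r : R, n • x = 1 ⊗ₜ r := by
  induction x using TensorProduct.induction_on with
  | zero => exact ⟨1, one_pos, 0, by simp⟩
  | tmul k r =>
    refine ⟨k.den, k.pos, k.num • r, ?_⟩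
    rw [TensorProduct.smul_tmul', TensorProduct.tmul_smul, TensorProduct.smul_tmul']
    congr 1
    rw [nsmul_eq_mul, zsmul_eq_mul, mul_one, mul_comm, Rat.mul_den_eq_num]
  | add x y hx hy =>
    obtain ⟨n, hn, r, hx⟩ := hx
    obtain ⟨m, hm, r', hy⟩ := hy
    refine ⟨n * m, Nat.mul_pos hn hm, m • r + n • r', ?_⟩
    rw [smul_add, mul_smul, mul_smul, smul_comm n m x, hx, hy, TensorProduct.tmul_add,
      TensorProduct.tmul_smul, TensorProduct.tmul_smul]

/-- `𝒜 ∩ R̄ = R`. -/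
theorem ofRat_mem_unitBall {x : RatAlg R} : ofRat S x ∈ unitBall S ↔ ∃ r : R, x = 1 ⊗ₜ r := by
  constructor
  · rintro ⟨y, hy⟩
    obtain ⟨n, hn, r, hx⟩ := exists_nsmul_eq_one_tmul x
    have h1 : incl S (n • y) = incl S (Completion.of r) := by
      rw [map_nsmul, hy, ← map_nsmul, hx, ofRat_one_tmul]
    have h2 := incl_injective h1
    rw [← posInt_smul n hn] at h2
    have h3 := (Completion.exists_smul_eq_iff _ _).1 ⟨y, h2⟩
    obtain ⟨r', hr'⟩ := mem_principal.1 ((QuotientAddGroup.eq_zero_iff _).1 h3)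
    refine ⟨r', smul_right_injective (RatAlg R) (Nat.cast_ne_zero (R := ℚ).2 hn.ne') ?_⟩
    beta_reduce
    rw [Nat.cast_smul_eq_nsmul, Nat.cast_smul_eq_nsmul, hx, ← hr', ← TensorProduct.tmul_smul,
      nsmul_eq_mul]
    rfl
  · rintro ⟨r, rfl⟩
    exact ⟨Completion.of r, (ofRat_one_tmul r).symm⟩

/-- `𝒜` is dense in `𝒜̄`. -/
theorem exists_sub_ofRat_mem_unitBall (x : FullCompletion S) :
    ∃ r : RatAlg R, x - ofRat S r ∈ unitBall S := by
  obtain ⟨s, y, rfl⟩ := exists_eq_inv_num_smul x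
  obtain ⟨r, hr⟩ := Completion.proj_surjective_of (principal s) y
  have h : Completion.proj (principal s) (y - Completion.of r) = 0 := by
    rw [map_sub, hr, Completion.proj_of, sub_self]
  obtain ⟨z, hz⟩ := (Completion.exists_smul_eq_iff s _).2 h
  refine ⟨embed S (num s)⁻¹ * (1 ⊗ₜ r : RatAlg R), z, ?_⟩
  rw [ofRat_smul, ← smul_sub, eq_inv_smul_iff, ofRat_one_tmul, ← incl_apply, ← map_sub, ← hz]
  exact num_smul_oreDiv_one s z

/-- Density of `𝒜` relative to the compact open subgroup `a R̄`. -/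
theorem exists_inv_smul_sub_ofRat_mem (a : QuotGroup S) (x : FullCompletion S) :
    ∃ r : RatAlg R, a⁻¹ • (x - ofRat S r) ∈ unitBall S := by
  obtain ⟨r, hr⟩ := exists_sub_ofRat_mem_unitBall (a⁻¹ • x)
  refine ⟨embed S a * r, ?_⟩
  rwa [ofRat_smul, smul_sub, inv_smul_smul]

/-- A continuous function to a discrete space is locally constant with respect to the subgroups
`n R̄`. -/
theorem exists_forall_add_smul_eq {f : FullCompletion S → ℤ} (hf : Continuous f)
    (x : FullCompletion S) : ∃ (n : ℕ) (hn : 0 < n), ∀ z ∈ unitBall S,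
      f (x + (ofNat n hn : QuotGroup S) • z) = f x := by
  induction x using OreLocalization.ind with
  | _ y s =>
    obtain ⟨n, hn, h⟩ := Completion.exists_forall_add_nsmul_mem
      ((isOpen_discrete {f (y /ₒ s)}).preimage (continuous_iff.1 hf s)) (y := y) rfl
    refine ⟨n, hn, ?_⟩
    rintro _ ⟨w, rfl⟩
    have h2 : (ofNat n hn : QuotGroup S) • incl S w = (n • (s.1 • w)) /ₒ s := by
      rw [incl_apply, ofNat_smul_oreDiv_one, smul_comm]
      exact (oreDiv_eq_incl_iff.2 rfl).symm
    rw [h2, OreLocalization.add_oreDiv]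
    exact h (s.1 • w)

end FullCompletion

end LocallyCompact

end RingHomology

namespace RingHomology

/-! ### Compactly supported functions on `𝒜̄` -/

section Functions

open QuotGroup FullCompletion

variable {R : Type} [Ring R] {S : Submonoid R} [Module.Finite ℤ R] [hS : IsAdmissible S]
  [Module.Free ℤ R]

variable (S) in
/-- The characteristic function of `R̄ ⊆ 𝒜̄`. -/
noncomputable def ballInd : Coeff S where
  toFun := (unitBall S : Set (FullCompletion S)).indicator 1
  continuous_toFun := continuous_one.indicator
    (fun x hx => by
      rw [IsClopen.frontier_eq ⟨isClosed_unitBall, isOpen_unitBall⟩] at hx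
      exact hx.elim)
  hasCompactSupport' := HasCompactSupport.intro' isCompact_unitBall isClosed_unitBall
    fun _ hx => Set.indicator_of_notMem hx _

theorem ballInd_apply (x : FullCompletion S) :
    ballInd S x = (unitBall S : Set (FullCompletion S)).indicator 1 x := rfl

theorem ballInd_of_mem {x : FullCompletion S} (hx : x ∈ unitBall S) : ballInd S x = 1 := by
  rw [ballInd_apply, Set.indicator_of_mem hx, Pi.one_apply]

theorem ballInd_of_notMem {x : FullCompletion S} (hx : x ∉ unitBall S) : ballInd S x = 0 := by
  rw [ballInd_apply, Set.indicator_of_notMem hx]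

theorem ballInd_congr {x y : FullCompletion S} (h : x ∈ unitBall S ↔ y ∈ unitBall S) :
    ballInd S x = ballInd S y := by
  by_cases hx : x ∈ unitBall S
  · rw [ballInd_of_mem hx, ballInd_of_mem (h.1 hx)]
  · rw [ballInd_of_notMem hx, ballInd_of_notMem (mt h.2 hx)]

/-- The action `f ↦ f ∘ σ̃_a⁻¹` of `𝒮` on `ℤ𝒜̄`. -/
noncomputable def dilate (a : QuotGroup S) : Coeff S →+ Coeff S :=
  (pushforward (mulHomeo a)).toAddMonoidHom

theorem dilate_apply (a : QuotGroup S) (f : Coeff S) (x : FullCompletion S) :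
    dilate a f x = f (a⁻¹ • x) := rfl

variable (S) in
/-- The translation action of `𝒜` on `ℤ𝒜̄`. -/
noncomputable def shift (b : RatAlg R) : Coeff S →+ Coeff S :=
  (pushforward (translate (ofRat S b))).toAddMonoidHom

theorem shift_apply (b : RatAlg R) (f : Coeff S) (x : FullCompletion S) :
    shift S b f x = f (x - ofRat S b) := congrArg f (sub_eq_add_neg x _).symm

theorem shift_shift (b c : RatAlg R) (f : Coeff S) :
    shift S b (shift S c f) = shift S (b + c) f := by
  ext x
  rw [shift_apply, shift_apply, shift_apply, map_add, sub_add_eq_sub_sub]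

theorem dilate_dilate (a b : QuotGroup S) (f : Coeff S) :
    dilate a (dilate b f) = dilate (a * b) f := by
  ext x
  rw [dilate_apply, dilate_apply, dilate_apply, mul_inv_rev, mul_smul]

theorem dilate_shift (a : QuotGroup S) (b : RatAlg R) (f : Coeff S) :
    dilate a (shift S b f) = shift S (embed S a * b) (dilate a f) := by
  ext x
  rw [dilate_apply, shift_apply, shift_apply, dilate_apply, ofRat_smul, smul_sub, inv_smul_smul]

/-- The lattice `a R` in `𝒜`. -/
noncomputable def lattice (a : QuotGroup S) : Submodule ℤ (RatAlg R) :=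
  LinearMap.range (LinearMap.mulLeft ℤ (embed S a : RatAlg R) ∘ₗ TensorProduct.mk ℤ ℚ R 1)

theorem mem_lattice {a : QuotGroup S} {x : RatAlg R} :
    x ∈ lattice a ↔ ∃ r : R, embed S a * (1 ⊗ₜ r : RatAlg R) = x := Iff.rfl

theorem mem_lattice_iff {a : QuotGroup S} {x : RatAlg R} :
    x ∈ lattice a ↔ a⁻¹ • ofRat S x ∈ unitBall S := by
  rw [← ofRat_smul, ofRat_mem_unitBall, mem_lattice]
  refine exists_congr fun r => ?_
  rw [map_inv, Units.inv_mul_eq_iff_eq_mul, eq_comm]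

/-- The characteristic function of `b + a R̄`. -/
noncomputable def cosetInd (a : QuotGroup S) (b : RatAlg R) : Coeff S :=
  shift S b (dilate a (ballInd S))

theorem cosetInd_apply (a : QuotGroup S) (b : RatAlg R) (x : FullCompletion S) :
    cosetInd a b x = ballInd S (a⁻¹ • (x - ofRat S b)) := by
  rw [cosetInd, shift_apply, dilate_apply]

theorem cosetInd_of_mem {a : QuotGroup S} {b : RatAlg R} {x : FullCompletion S}
    (hx : a⁻¹ • (x - ofRat S b) ∈ unitBall S) (c : RatAlg R) [Decidable (b - c ∈ lattice a)] :
    cosetInd a c x = if b - c ∈ lattice a then 1 else 0 := by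
  have h : a⁻¹ • (x - ofRat S c) = a⁻¹ • (x - ofRat S b) + a⁻¹ • ofRat S (b - c) := by
    rw [← smul_add, map_sub, sub_add_sub_cancel]
  rw [cosetInd_apply]
  split_ifs with hbc
  · rw [h]
    exact ballInd_of_mem (add_mem hx (mem_lattice_iff.1 hbc))
  · refine ballInd_of_notMem fun h' => hbc (mem_lattice_iff.2 ?_)
    rw [h] at h'
    simpa using sub_mem h' hx

theorem cosetInd_congr {a : QuotGroup S} {b c : RatAlg R} (h : b - c ∈ lattice a) :
    cosetInd a b = cosetInd a c := by
  ext x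
  rw [cosetInd_apply, cosetInd_apply]
  refine ballInd_congr ?_
  have h1 : a⁻¹ • (x - ofRat S c) = a⁻¹ • (x - ofRat S b) + a⁻¹ • ofRat S (b - c) := by
    rw [← smul_add, map_sub, sub_add_sub_cancel]
  rw [h1]
  exact ((unitBall S).add_mem_cancel_right (mem_lattice_iff.1 h)).symm

/-- The map `ℤ[𝒜 ⧸ a R] → ℤ𝒜̄` sending the coset of `b` to the characteristic function
of `b + a R̄`. -/
noncomputable def stepMap (a : QuotGroup S) : ((RatAlg R ⧸ lattice a) →₀ ℤ) →+ Coeff S :=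
  Finsupp.liftAddHom fun x => (zmultiplesHom (Coeff S)) (cosetInd a x.out)

theorem stepMap_single (a : QuotGroup S) (b : RatAlg R) (k : ℤ) :
    stepMap a (Finsupp.single ((lattice a).mkQ b) k) = k • cosetInd a b := by
  rw [stepMap, Finsupp.liftAddHom_apply_single, zmultiplesHom_apply]
  congr 1
  exact cosetInd_congr ((Submodule.Quotient.eq _).1 (mk_out_eq _ _))

theorem stepMap_apply {a : QuotGroup S} {b : RatAlg R} {x : FullCompletion S}
    (hx : a⁻¹ • (x - ofRat S b) ∈ unitBall S) (p : (RatAlg R ⧸ lattice a) →₀ ℤ) :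
    stepMap a p x = p ((lattice a).mkQ b) := by
  classical
  induction p using Finsupp.induction_linear with
  | zero => rw [map_zero]; rfl
  | add p p' h1 h2 =>
    rw [map_add, Finsupp.add_apply, ← h1, ← h2]; rfl
  | single y k =>
    obtain ⟨c, rfl⟩ := (lattice a).mkQ_surjective y
    rw [stepMap_single, Finsupp.single_apply]
    change k • cosetInd a c x = _
    rw [cosetInd_of_mem hx]
    have : (lattice a).mkQ c = (lattice a).mkQ b ↔ b - c ∈ lattice a :=
      eq_comm.trans (Submodule.Quotient.eq _)
    simp only [this]
    split_ifs <;> simp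

theorem stepMap_injective (a : QuotGroup S) : Function.Injective (stepMap a) := by
  intro p p' h
  ext y
  obtain ⟨b, rfl⟩ := (lattice a).mkQ_surjective y
  have hb : a⁻¹ • (ofRat S b - ofRat S b) ∈ unitBall S := by
    rw [sub_self, smul_zero]; exact zero_mem _
  rw [← stepMap_apply hb, ← stepMap_apply hb, h]

/-- A compactly supported function which is invariant under `a R̄` comes from `ℤ[𝒜 ⧸ a R]`. -/
theorem exists_stepMap_eq_of_invariant (a : QuotGroup S) (f : Coeff S)
    (hf : ∀ x, ∀ z ∈ unitBall S, f (x + a • z) = f x) : ∃ p, stepMap a p = f := by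
  have hinv {x : FullCompletion S} {b : RatAlg R} (hx : a⁻¹ • (x - ofRat S b) ∈ unitBall S) :
      f x = f (ofRat S b) := by
    rw [← hf (ofRat S b) _ hx, smul_inv_smul, add_sub_cancel]
  obtain ⟨t, ht⟩ := f.hasCompactSupport.elim_finite_subcover
    (fun b : RatAlg R => {x | a⁻¹ • (x - ofRat S b) ∈ unitBall S})
    (fun b => isOpen_unitBall.preimage ((continuous_smul a⁻¹).comp (by
      simpa only [sub_eq_add_neg] using continuous_add_right (-ofRat S b))))
    (fun x _ => Set.mem_iUnion.2 (exists_inv_smul_sub_ofRat_mem a x))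
  have hfin : {y : RatAlg R ⧸ lattice a | f (ofRat S y.out) ≠ 0}.Finite := by
    refine (t.finite_toSet.image (lattice a).mkQ).subset fun y hy => ?_
    obtain ⟨b, hb, h⟩ := Set.mem_iUnion₂.1 (ht (subset_closure hy))
    refine ⟨b, hb, ?_⟩
    rw [← mk_out_eq _ y]
    refine ((Submodule.Quotient.eq _).2 (mem_lattice_iff.2 ?_)).symm
    rw [map_sub]
    exact h
  refine ⟨Finsupp.ofSupportFinite (fun y => f (ofRat S y.out)) hfin, ?_⟩
  ext x
  obtain ⟨b, hb⟩ := exists_inv_smul_sub_ofRat_mem a x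
  rw [stepMap_apply hb]
  refine (hinv ?_).symm
  rw [← sub_add_sub_cancel x (ofRat S b), smul_add, ← map_sub]
  exact add_mem hb (mem_lattice_iff.1 ((Submodule.Quotient.eq _).1 (mk_out_eq _ _).symm))

/-- Every compactly supported function is invariant under some `n R̄`. -/
theorem exists_stepMap_eq (f : Coeff S) :
    ∃ (n : ℕ) (hn : 0 < n) (p : _), stepMap (ofNat n hn : QuotGroup S) p = f := by
  choose n hn h using exists_forall_add_smul_eq (S := S) (map_continuous f)
  have hopen (x : FullCompletion S) :
      IsOpen {y | (ofNat (n x) (hn x) : QuotGroup S)⁻¹ • (y - x) ∈ unitBall S} :=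
    isOpen_unitBall.preimage ((continuous_smul _).comp (by
      simpa only [sub_eq_add_neg] using continuous_add_right (-x)))
  obtain ⟨t, ht⟩ := f.hasCompactSupport.elim_finite_subcover _ hopen
    (fun x _ => Set.mem_iUnion.2 ⟨x, by
      change _ • (x - x) ∈ unitBall S
      rw [sub_self, smul_zero]; exact zero_mem _⟩)
  have hN : 0 < ∏ x ∈ t, n x := Finset.prod_pos fun x _ => hn x
  have key (y : FullCompletion S) (hy : y ∈ tsupport f) (z : FullCompletion S)
      (hz : z ∈ unitBall S) : f (y + (ofNat _ hN : QuotGroup S) • z) = f y := by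
    obtain ⟨x, hx, hxy⟩ := Set.mem_iUnion₂.1 (ht hy)
    obtain ⟨k, hk⟩ := Finset.dvd_prod_of_mem n hx
    have hkpos : 0 < k := Nat.pos_of_ne_zero fun h0 => hN.ne' (by rw [hk, h0, mul_zero])
    have h1 : (ofNat _ hN : QuotGroup S) = ofNat (n x) (hn x) * ofNat k hkpos := by
      rw [← ofNat_mul]
      congr 1
    have h2 : y = x + (ofNat (n x) (hn x) : QuotGroup S) •
        ((ofNat (n x) (hn x) : QuotGroup S)⁻¹ • (y - x)) := by
      rw [smul_inv_smul, add_sub_cancel]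
    have h3 := h x _ hxy
    rw [← h2] at h3
    rw [h3, h1, mul_smul]
    conv_lhs => rw [h2]
    rw [add_assoc, ← smul_add]
    exact h x _ (add_mem hxy (num_smul_mem_unitBall _ hz))
  obtain ⟨p, hp⟩ := exists_stepMap_eq_of_invariant (ofNat _ hN) f fun x z hz => by
    by_cases hx : x ∈ tsupport f
    · exact key x hx z hz
    by_cases hx' : x + (ofNat _ hN : QuotGroup S) • z ∈ tsupport f
    · have := key _ hx' (-z) (neg_mem hz)
      rw [smul_neg, add_neg_cancel_right] at this
      exact this.symm
    · rw [image_eq_zero_of_notMem_tsupport hx, image_eq_zero_of_notMem_tsupport hx']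
  exact ⟨_, hN, p, hp⟩

theorem stepMap_quotRep (a : QuotGroup S) (b : Multiplicative (RatAlg R))
    (p : (RatAlg R ⧸ lattice a) →₀ ℤ) :
    stepMap a (quotRep (lattice a) b p) = translationRep S b (stepMap a p) := by
  change _ = shift S b.toAdd (stepMap a p)
  induction p using Finsupp.induction_linear with
  | zero => simp
  | add p p' h1 h2 => rw [map_add, map_add, h1, h2, map_add, map_add]
  | single y k =>
    obtain ⟨c, rfl⟩ := (lattice a).mkQ_surjective y
    rw [quotRep_single, ← map_add, stepMap_single, stepMap_single, map_zsmul, cosetInd, cosetInd,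
      shift_shift]

/-- `R̄` is the disjoint union of the translates of `s R̄` by representatives of `R ⧸ s R`. -/
theorem ballInd_eq_sum (s : S) [Fintype (R ⧸ (principal s).1)] :
    ballInd S = ∑ y : R ⧸ (principal s).1, cosetInd (num s) (1 ⊗ₜ y.out) := by
  classical
  ext z
  have h0 (y : R ⧸ (principal s).1) : cosetInd (num s) (1 ⊗ₜ y.out : RatAlg R) z =
      ballInd S ((num s)⁻¹ • (z - incl S (Completion.of y.out))) := by
    rw [cosetInd_apply, ofRat_one_tmul]
  have hsum : (∑ y : R ⧸ (principal s).1, cosetInd (num s) (1 ⊗ₜ y.out) : Coeff S) z =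
      ∑ y : R ⧸ (principal s).1, cosetInd (num s) (1 ⊗ₜ y.out : RatAlg R) z :=
    map_sum (⟨⟨fun f => f z, rfl⟩, fun _ _ => rfl⟩ : Coeff S →+ ℤ) _ _
  rw [hsum]
  simp only [h0]
  by_cases hz : z ∈ unitBall S
  · rw [ballInd_of_mem hz]
    obtain ⟨w, rfl⟩ := hz
    have h1 (y : R ⧸ (principal s).1) :
        ballInd S ((num s)⁻¹ • (incl S w - incl S (Completion.of y.out))) =
          if Completion.proj (principal s) w = y then 1 else 0 := by
      have h2 : (num s)⁻¹ • (incl S w - incl S (Completion.of y.out)) ∈ unitBall S ↔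
          Completion.proj (principal s) w = y := by
        rw [← map_sub, incl_apply, inv_num_smul_oreDiv_one, oreDiv_mem_unitBall, map_sub,
          Completion.proj_of, sub_eq_zero, QuotientAddGroup.out_eq']
      split_ifs with h
      · exact ballInd_of_mem (h2.2 h)
      · exact ballInd_of_notMem (mt h2.1 h)
    simp only [h1]
    simp
  · rw [ballInd_of_notMem hz]
    refine (Finset.sum_eq_zero fun y _ => ballInd_of_notMem fun h => hz ?_).symm
    have h1 := num_smul_mem_unitBall s h
    rw [smul_inv_smul] at h1
    simpa using add_mem h1 (⟨_, rfl⟩ : incl S (Completion.of y.out) ∈ unitBall S)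

end Functions

end RingHomology

namespace RingHomology

/-! ### The invariant integral -/

section Integral

open QuotGroup FullCompletion

variable {R : Type} [Ring R] {S : Submonoid R} [Module.Finite ℤ R] [hS : IsAdmissible S]
  [Module.Free ℤ R]

theorem ratNorm_mul (a b : QuotGroup S) : ratNorm (a * b) = ratNorm a * ratNorm b := by
  rw [ratNorm, ratNorm, ratNorm, ← LinearMap.det_comp, map_mul, Units.val_mul]
  congr 1
  ext x
  simp

theorem ratNorm_one : ratNorm (1 : QuotGroup S) = 1 := by
  rw [ratNorm, map_one, Units.val_one, LinearMap.mulLeft_one, LinearMap.det_id]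

theorem ratNorm_ne_zero (a : QuotGroup S) : ratNorm a ≠ 0 := by
  intro h
  have := ratNorm_mul a a⁻¹
  rw [mul_inv_cancel, ratNorm_one, h, zero_mul] at this
  exact one_ne_zero this

theorem abs_ratNorm_ne_zero (a : QuotGroup S) : |ratNorm a| ≠ 0 := abs_ne_zero.2 (ratNorm_ne_zero a)

theorem abs_ratNorm_num (s : S) : |ratNorm (num s)| = Nat.card (R ⧸ (principal s).1) := by
  have hinj : Function.Injective (LinearMap.mulLeft ℤ (s : R)) := hS.isLeftRegular s s.2
  have h1 := Submodule.natAbs_det_equiv (LinearMap.range (LinearMap.mulLeft ℤ (s : R)))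
    (LinearEquiv.ofInjective _ hinj)
  have h2 : Nat.card (R ⧸ LinearMap.range (LinearMap.mulLeft ℤ (s : R))) =
      Nat.card (R ⧸ (principal s).1) := by
    refine Nat.card_congr (QuotientAddGroup.quotientAddEquivOfEq
      (M := (LinearMap.range (LinearMap.mulLeft ℤ (s : R))).toAddSubgroup) ?_).toEquiv
    ext r
    exact mem_principal.symm
  have h3 : LinearMap.mulLeft ℚ ((embed S (num s) : RatAlg R)) =
      (LinearMap.mulLeft ℤ (s : R)).baseChange ℚ := by
    rw [coe_embed_num]
    ext x
    simp
  have h4 : (LinearMap.range (LinearMap.mulLeft ℤ (s : R))).subtype ∘ₗ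
      AddMonoidHom.toIntLinearMap ((LinearEquiv.ofInjective _ hinj :
        R ≃ₗ[ℤ] LinearMap.range (LinearMap.mulLeft ℤ (s : R))) : R →+ _) =
      LinearMap.mulLeft ℤ (s : R) := rfl
  rw [h4, h2] at h1
  rw [ratNorm, h3, LinearMap.det_baseChange, ← h1, eq_intCast, ← Int.cast_abs, Int.abs_eq_natAbs,
    Int.cast_natCast]

theorem ratNorm_ofNat (n : ℕ) (hn : 0 < n) :
    ratNorm (ofNat n hn : QuotGroup S) = (n : ℚ) ^ Module.finrank ℤ R := by
  have h : LinearMap.mulLeft ℚ (embed S (ofNat n hn : QuotGroup S) : RatAlg R) =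
      (n : ℚ) • LinearMap.id := by
    rw [coe_embed_ofNat]
    ext x
    simp [Algebra.smul_def]
  rw [ratNorm, h, LinearMap.det_smul, LinearMap.det_id, mul_one, Module.finrank_baseChange]

/-- The sum of the coefficients. -/
noncomputable def coeffSum (X : Type) : (X →₀ ℤ) →+ ℤ :=
  Finsupp.liftAddHom fun _ => AddMonoidHom.id ℤ

theorem coeffSum_single {X : Type} (x : X) (k : ℤ) : coeffSum X (Finsupp.single x k) = k :=
  Finsupp.liftAddHom_apply_single _ _ _

/-- Passing from `a R` to the sublattice `a s R` multiplies the sum of the coefficients by the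
index of `s R` in `R`. -/
theorem exists_refine (a : QuotGroup S) (s : S) (p : (RatAlg R ⧸ lattice a) →₀ ℤ) :
    ∃ p', stepMap (a * num s) p' = stepMap a p ∧
      (coeffSum _ p' : ℚ) = |ratNorm (num s)| * coeffSum _ p := by
  have : Finite (R ⧸ (principal s).1) := Completion.finite_quotient (principal s)
  have := Fintype.ofFinite (R ⧸ (principal s).1)
  induction p using Finsupp.induction_linear with
  | zero => exact ⟨0, by simp⟩
  | add p q hp hq =>
    obtain ⟨p', hp, hp'⟩ := hp
    obtain ⟨q', hq, hq'⟩ := hq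
    refine ⟨p' + q', by rw [map_add, map_add, hp, hq], ?_⟩
    rw [map_add, map_add, Int.cast_add, Int.cast_add, hp', hq', mul_add]
  | single y k =>
    obtain ⟨b, rfl⟩ := (lattice a).mkQ_surjective y
    refine ⟨∑ y : R ⧸ (principal s).1, Finsupp.single
      ((lattice (a * num s)).mkQ (b + embed S a * (1 ⊗ₜ y.out : RatAlg R))) k, ?_, ?_⟩
    · rw [map_sum, stepMap_single, cosetInd, ballInd_eq_sum s, map_sum, map_sum, Finset.smul_sum]
      refine Finset.sum_congr rfl fun y _ => ?_
      rw [stepMap_single, cosetInd, cosetInd, dilate_shift, shift_shift, dilate_dilate]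
    · simp only [map_sum, coeffSum_single, Finset.sum_const, Finset.card_univ, nsmul_eq_mul]
      rw [abs_ratNorm_num, Nat.card_eq_fintype_card]
      push_cast
      rfl

theorem coeffSum_div_eq_of_stepMap_eq {a b : QuotGroup S} {p : (RatAlg R ⧸ lattice a) →₀ ℤ}
    {q : (RatAlg R ⧸ lattice b) →₀ ℤ} (h : stepMap a p = stepMap b q) :
    |ratNorm a|⁻¹ * coeffSum _ p = |ratNorm b|⁻¹ * coeffSum _ q := by
  obtain ⟨s, t, hst⟩ := exists_mul_num_eq a b
  obtain ⟨p', hp, hp'⟩ := exists_refine a s p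
  obtain ⟨q', hq, hq'⟩ := exists_refine b t q
  have hN : |ratNorm a| * |ratNorm (num s)| = |ratNorm b| * |ratNorm (num t)| := by
    rw [← abs_mul, ← abs_mul, ← ratNorm_mul, ← ratNorm_mul, hst]
  have hpq : (coeffSum _ p' : ℚ) = coeffSum _ q' := by
    revert q'
    rw [← hst]
    intro q' hq hq'
    rw [stepMap_injective _ (hp.trans (h.trans hq.symm))]
  rw [hp', hq'] at hpq
  have h1 := abs_ratNorm_ne_zero a
  have h2 := abs_ratNorm_ne_zero b
  have h3 := abs_ratNorm_ne_zero (num s)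
  have h4 := abs_ratNorm_ne_zero (num t)
  rw [inv_mul_eq_iff_eq_mul₀ h1, mul_left_comm, eq_inv_mul_iff_mul_eq₀ h2]
  refine mul_left_cancel₀ h3 ?_
  linear_combination |ratNorm b| * hpq - coeffSum _ q * hN

theorem exists_stepMap_eq' (f : Coeff S) :
    ∃ x : Σ a : QuotGroup S, ((RatAlg R ⧸ lattice a) →₀ ℤ), stepMap x.1 x.2 = f := by
  obtain ⟨n, hn, p, hp⟩ := exists_stepMap_eq f
  exact ⟨⟨_, p⟩, hp⟩

/-- The integral of a compactly supported integer-valued function with respect to the Haar measure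
for which `R̄` has volume `1`: if `f` is invariant under `a R̄`, it is `|N(a)|⁻¹` times the sum of
the values of `f` on `𝒜 ⧸ a R`. -/
noncomputable def integral (f : Coeff S) : ℚ :=
  |ratNorm (exists_stepMap_eq' f).choose.1|⁻¹ * coeffSum _ (exists_stepMap_eq' f).choose.2

theorem integral_stepMap (a : QuotGroup S) (p : (RatAlg R ⧸ lattice a) →₀ ℤ) :
    integral (stepMap a p) = |ratNorm a|⁻¹ * coeffSum _ p :=
  coeffSum_div_eq_of_stepMap_eq (exists_stepMap_eq' (stepMap a p)).choose_spec

theorem exists_common_stepMap {a b : QuotGroup S} (p : (RatAlg R ⧸ lattice a) →₀ ℤ)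
    (q : (RatAlg R ⧸ lattice b) →₀ ℤ) :
    ∃ (c : QuotGroup S) (p' q' : (RatAlg R ⧸ lattice c) →₀ ℤ),
      stepMap c p' = stepMap a p ∧ stepMap c q' = stepMap b q := by
  obtain ⟨s, t, hst⟩ := exists_mul_num_eq a b
  obtain ⟨p', hp, -⟩ := exists_refine a s p
  have h := exists_refine b t q
  rw [← hst] at h
  obtain ⟨q', hq, -⟩ := h
  exact ⟨_, p', q', hp, hq⟩

theorem integral_add (f g : Coeff S) : integral (f + g) = integral f + integral g := by
  obtain ⟨⟨a, p⟩, rfl⟩ := exists_stepMap_eq' f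
  obtain ⟨⟨b, q⟩, rfl⟩ := exists_stepMap_eq' g
  obtain ⟨c, p', q', hp, hq⟩ := exists_common_stepMap p q
  dsimp only
  rw [← hp, ← hq, ← map_add, integral_stepMap, integral_stepMap, integral_stepMap, map_add,
    Int.cast_add, mul_add]

variable (S) in
/-- The integral as a homomorphism. -/
noncomputable def integralHom : Coeff S →+ ℚ := AddMonoidHom.mk' integral integral_add

theorem integralHom_stepMap (a : QuotGroup S) (p : (RatAlg R ⧸ lattice a) →₀ ℤ) :
    integralHom S (stepMap a p) = |ratNorm a|⁻¹ * coeffSum _ p := integral_stepMap a p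

theorem integralHom_translationRep (b : Multiplicative (RatAlg R)) (f : Coeff S) :
    integralHom S (translationRep S b f) = integralHom S f := by
  obtain ⟨⟨a, p⟩, rfl⟩ := exists_stepMap_eq' f
  rw [← stepMap_quotRep, integralHom_stepMap, integralHom_stepMap]
  congr 2
  induction p using Finsupp.induction_linear with
  | zero => simp
  | add p p' h1 h2 => rw [map_add, map_add, h1, h2, map_add]
  | single y k => rw [quotRep_single, coeffSum_single, coeffSum_single]

theorem integralHom_dilate (a : QuotGroup S) (f : Coeff S) :
    integralHom S (dilate a f) = |ratNorm a|⁻¹ * integralHom S f := by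
  obtain ⟨⟨b, p⟩, rfl⟩ := exists_stepMap_eq' f
  have h : ∃ p', stepMap (a * b) p' = dilate a (stepMap b p) ∧ coeffSum _ p' = coeffSum _ p := by
    induction p using Finsupp.induction_linear with
    | zero => exact ⟨0, by simp⟩
    | add p q hp hq =>
      obtain ⟨p', hp, hp'⟩ := hp
      obtain ⟨q', hq, hq'⟩ := hq
      exact ⟨p' + q', by rw [map_add, map_add, map_add, hp, hq], by
        rw [map_add, map_add, hp', hq']⟩
    | single y k =>
      obtain ⟨c, rfl⟩ := (lattice b).mkQ_surjective y
      refine ⟨Finsupp.single ((lattice (a * b)).mkQ (embed S a * c)) k, ?_, ?_⟩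
      · rw [stepMap_single, stepMap_single, map_zsmul, cosetInd, cosetInd, dilate_shift,
          dilate_dilate]
      · rw [coeffSum_single, coeffSum_single]
  obtain ⟨p', h1, h2⟩ := h
  dsimp only
  rw [← h1, integralHom_stepMap, integralHom_stepMap, h2, ratNorm_mul, abs_mul, mul_inv, mul_assoc]

theorem integralHom_ballInd : integralHom S (ballInd S) = 1 := by
  have h : stepMap 1 (Finsupp.single ((lattice (1 : QuotGroup S)).mkQ 0) 1) = ballInd S := by
    rw [stepMap_single, one_smul]
    ext x
    rw [cosetInd_apply, map_zero, sub_zero, inv_one, one_smul]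
  rw [← h, integralHom_stepMap, coeffSum_single, ratNorm_one]
  simp

end Integral

end RingHomology

namespace RingHomology

/-! ### The comparison map to the exterior powers -/

section Comparison

open QuotGroup FullCompletion Finsupp

variable {R : Type} [Ring R] {S : Submonoid R} [Module.Finite ℤ R] [hS : IsAdmissible S]
  [Module.Free ℤ R]

variable (S) in
/-- The map `[x₁ | ⋯ | x_q] ⊗ f ↦ (1 / q!) (∫ f) x₁ ∧ ⋯ ∧ x_q` on inhomogeneous chains. -/
noncomputable def wedgeIntegral (q : ℕ) :
    ((Fin q → Multiplicative (RatAlg R)) →₀ Coeff S) →+ ⋀[ℚ]^q (RatAlg R) :=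
  liftAddHom fun g => (LinearMap.toSpanSingleton ℚ (⋀[ℚ]^q (RatAlg R))
    ((q.factorial : ℚ)⁻¹ • exteriorPower.ιMulti ℚ q fun i => (g i).toAdd)).toAddMonoidHom.comp
      (integralHom S)

theorem wedgeIntegral_single (q : ℕ) (g : Fin q → Multiplicative (RatAlg R)) (f : Coeff S) :
    wedgeIntegral S q (single g f) = integralHom S f •
      (q.factorial : ℚ)⁻¹ • exteriorPower.ιMulti ℚ q fun i => (g i).toAdd :=
  liftAddHom_apply_single _ _ _

/-- A multilinear map vanishes on the boundary of the bar construction: the terms in which one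
letter is omitted telescope. -/
theorem multilinear_bar_boundary {A N : Type} [AddCommGroup A] [AddCommGroup N] [Module ℚ A]
    [Module ℚ N] {q : ℕ} (ω : MultilinearMap ℚ (fun _ : Fin q => A) N)
    (g : Fin (q + 1) → Multiplicative A) :
    ω (fun i => (g i.succ).toAdd) + ∑ j : Fin (q + 1), (-1 : ℤ) ^ ((j : ℕ) + 1) •
      ω (fun i => (Fin.contractNth j (· * ·) g i).toAdd) = 0 := by
  let w : Fin (q + 1) → N := fun j => ω fun i => (g (j.succAbove i)).toAdd
  have hlast : ω (fun i => (Fin.contractNth (Fin.last q) (· * ·) g i).toAdd) = w (Fin.last q) := by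
    refine congrArg ω (funext fun i => ?_)
    rw [Fin.contractNth_apply_of_lt _ _ _ _ i.2, Fin.succAbove_last]
  have hinner (j : Fin q) : ω (fun i => (Fin.contractNth j.castSucc (· * ·) g i).toAdd) =
      w j.castSucc + w j.succ := by
    have h1 : (fun i => (Fin.contractNth j.castSucc (· * ·) g i).toAdd) =
        Function.update (fun i => (g (j.succ.succAbove i)).toAdd) j
          ((g j.succ).toAdd + (g j.castSucc).toAdd) := by
      funext i
      rcases lt_trichotomy i j with h | h | h
      · rw [Function.update_of_ne h.ne, Fin.contractNth_apply_of_lt _ _ _ _ (by simpa using h),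
          Fin.succAbove_of_castSucc_lt _ _ (Fin.castSucc_lt_succ_iff.2 h.le)]
      · subst h
        rw [Function.update_self, Fin.contractNth_apply_of_eq _ _ _ _ rfl, add_comm]
        rfl
      · rw [Function.update_of_ne h.ne', Fin.contractNth_apply_of_gt _ _ _ _ (by simpa using h),
          Fin.succAbove_of_le_castSucc _ _ (Fin.succ_le_castSucc_iff.2 h)]
    rw [h1, MultilinearMap.map_update_add]
    congr 1
    · refine congrArg ω (funext fun i => ?_)
      rcases lt_trichotomy i j with h | h | h
      · rw [Function.update_of_ne h.ne,
          Fin.succAbove_of_castSucc_lt _ _ (Fin.castSucc_lt_succ_iff.2 h.le),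
          Fin.succAbove_of_castSucc_lt _ _ (Fin.castSucc_lt_castSucc_iff.2 h)]
      · subst h
        rw [Function.update_self, Fin.succAbove_castSucc_self]
      · rw [Function.update_of_ne h.ne',
          Fin.succAbove_of_le_castSucc _ _ (Fin.succ_le_castSucc_iff.2 h),
          Fin.succAbove_of_le_castSucc _ _ (Fin.castSucc_le_castSucc_iff.2 h.le)]
    · refine congrArg ω (funext fun i => ?_)
      by_cases h : i = j
      · subst h
        rw [Function.update_self, Fin.succAbove_succ_self]
      · rw [Function.update_of_ne h]
  have h1 := Fin.sum_univ_succ fun j : Fin (q + 1) => (-1 : ℤ) ^ (j : ℕ) • w j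
  have h2 := Fin.sum_univ_castSucc fun j : Fin (q + 1) => (-1 : ℤ) ^ (j : ℕ) • w j
  rw [h2] at h1
  rw [Fin.sum_univ_castSucc, hlast]
  simp only [hinner, smul_add, Finset.sum_add_distrib]
  simp only [Fin.val_castSucc, Fin.val_last, Fin.val_succ, Fin.val_zero, pow_zero, one_smul,
    pow_succ, mul_neg, mul_one, neg_smul, Finset.sum_neg_distrib] at h1 ⊢
  have h0 : ω (fun i => (g i.succ).toAdd) = w 0 := rfl
  rw [h0]
  have h3 : ∑ i : Fin q, (-1 : ℤ) ^ (i : ℕ) • w i.succ =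
      w 0 - (∑ i : Fin q, (-1 : ℤ) ^ (i : ℕ) • w i.castSucc + (-1 : ℤ) ^ q • w (Fin.last q)) := by
    rw [h1, sub_add_cancel_left, neg_neg]
  rw [h3]
  abel

theorem wedgeIntegral_chainD (q : ℕ)
    (y : (Fin (q + 1) → Multiplicative (RatAlg R)) →₀ Coeff S) :
    wedgeIntegral S q (chainD (coeffRep S) q y) = 0 := by
  suffices h : (wedgeIntegral S q).comp (chainD (coeffRep S) q) = 0 from DFunLike.congr_fun h y
  refine addHom_ext fun g f => ?_
  have h1 : integralHom S ((coeffRep S).ρ (g 0)⁻¹ f) = integralHom S f :=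
    integralHom_translationRep _ _
  rw [AddMonoidHom.comp_apply, chainD_single, map_add, map_sum, wedgeIntegral_single, h1]
  simp only [map_zsmul, wedgeIntegral_single]
  have h2 := multilinear_bar_boundary (exteriorPower.ιMulti ℚ q (M := RatAlg R)).toMultilinearMap g
  simp only [smul_comm ((-1 : ℤ) ^ _) (_ : ℚ)]
  rw [← Finset.smul_sum, ← Finset.smul_sum, ← smul_add, ← smul_add]
  refine (congrArg (fun v => integralHom S f • (q.factorial : ℚ)⁻¹ • v) h2).trans ?_
  rw [smul_zero, smul_zero]
  rfl

theorem wedgeIntegral_wedgeChain {q : ℕ} (t : Fin q → RatAlg R) (u : Coeff S) :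
    wedgeIntegral S q (wedgeChain (fun i => Multiplicative.ofAdd (t i)) u) =
      integralHom S u • exteriorPower.ιMulti ℚ q t := by
  rw [wedgeChain_apply, map_sum]
  have h (π : Equiv.Perm (Fin q)) : wedgeIntegral S q ((Equiv.Perm.sign π : ℤ) •
      single (fun i => Multiplicative.ofAdd (t (π i))) u) =
      integralHom S u • (q.factorial : ℚ)⁻¹ • exteriorPower.ιMulti ℚ q t := by
    rw [map_zsmul, wedgeIntegral_single]
    have h1 := (exteriorPower.ιMulti ℚ q (M := RatAlg R)).map_perm t π
    have h2 : (exteriorPower.ιMulti ℚ q fun i => (Multiplicative.ofAdd (t (π i))).toAdd) =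
        (Equiv.Perm.sign π : ℤ) • exteriorPower.ιMulti ℚ q t := h1
    rw [h2, smul_comm (Equiv.Perm.sign π : ℤ), smul_comm (Equiv.Perm.sign π : ℤ),
      smul_smul (Equiv.Perm.sign π : ℤ), ← Units.val_mul, Int.units_mul_self, Units.val_one,
      one_smul]
  rw [Finset.sum_congr rfl fun π _ => h π, Finset.sum_const, Finset.card_univ, Fintype.card_perm,
    Fintype.card_fin, smul_comm, ← Nat.cast_smul_eq_nsmul ℚ, smul_smul (q.factorial : ℚ),
    mul_inv_cancel₀ (Nat.cast_ne_zero.2 q.factorial_ne_zero), one_smul]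

/-! ### Homology classes and cycles -/

section Classes

variable {G : Type} [Group G] {M : Rep.{0} ℤ G}

theorem chainD_iCycles (q : ℕ) (z : groupHomology.cycles M (q + 1)) :
    chainD M q (groupHomology.iCycles M (q + 1) z) = 0 := by
  have h := HomologicalComplex.iCycles_d (groupHomology.inhomogeneousChains M) (q + 1) q
  rw [groupHomology.inhomogeneousChains.d_def] at h
  exact congrArg (fun f => f.hom z) h

theorem homologyπ_eq_zero_of_eq_chainD (q : ℕ) (z : groupHomology.cycles M q)
    (w : (Fin (q + 1) → G) →₀ M) (h : groupHomology.iCycles M q z = chainD M q w) :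
    groupHomology.π M q z = 0 := by
  have h1 : groupHomology.toCycles M (q + 1) q w = z := by
    refine (ModuleCat.mono_iff_injective (groupHomology.iCycles M q)).1 inferInstance ?_
    rw [h]
    have h2 := HomologicalComplex.toCycles_i (groupHomology.inhomogeneousChains M) (q + 1) q
    rw [groupHomology.inhomogeneousChains.d_def] at h2
    exact congrArg (fun f => f.hom w) h2
  rw [← h1]
  have h3 := HomologicalComplex.toCycles_comp_homologyπ (groupHomology.inhomogeneousChains M)
    (q + 1) q
  exact congrArg (fun f => f.hom w) h3

theorem exists_cycle_zero (y : (Fin 0 → G) →₀ M) :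
    ∃ z, groupHomology.iCycles M 0 z = y :=
  ⟨groupHomology.cyclesMk 0 0 (by simp) y (by
    rw [HomologicalComplex.shape _ _ _ (by simp)]; rfl), groupHomology.iCycles_mk _ _ _⟩

theorem exists_cycle_succ (q : ℕ) (y : (Fin (q + 1) → G) →₀ M) (hy : chainD M q y = 0) :
    ∃ z, groupHomology.iCycles M (q + 1) z = y :=
  ⟨groupHomology.cyclesMk (q + 1) q (by simp) y (by
    rw [groupHomology.inhomogeneousChains.d_def]; exact hy), groupHomology.iCycles_mk _ _ _⟩

theorem exists_complex_homology_desc {k : Type} [CommRing k] (K : ChainComplex (ModuleCat.{0} k) ℕ)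
    {N : ModuleCat.{0} k} (q : ℕ) (φ : K.X q ⟶ N) (hφ : K.d (q + 1) q ≫ φ = 0) :
    ∃ Φ : K.homology q ⟶ N, K.homologyπ q ≫ Φ = K.iCycles q ≫ φ :=
  ⟨K.homologyι q ≫ K.descOpcycles φ (q + 1) (by simp) hφ, by
    rw [HomologicalComplex.homology_π_ι_assoc, HomologicalComplex.p_descOpcycles]⟩

/-- An additive map is linear for any two `ℤ`-module structures. -/
def toIntLinear {X Y : Type} [AddCommGroup X] [AddCommGroup Y] [Module ℤ X] [Module ℤ Y]
    (f : X →+ Y) : X →ₗ[ℤ] Y where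
  toFun := f
  map_add' := map_add f
  map_smul' n x := by
    have := map_intCast_smul f ℤ ℤ n x
    rwa [Int.cast_id] at this

/-- A homomorphism on chains which vanishes on boundaries induces one on homology. -/
theorem exists_homology_desc {N : Type} [AddCommGroup N] (q : ℕ) (φ : ((Fin q → G) →₀ M) →+ N)
    (hφ : ∀ y, φ (chainD M q y) = 0) :
    ∃ Φ : groupHomology M q →+ N, ∀ z, Φ (groupHomology.π M q z) =
      φ (groupHomology.iCycles M q z) := by
  let inst : Module ℤ ((Fin q → G) →₀ M) := @Finsupp.module (Fin q → G) M ℤ _ _ M.hV2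
  let φ' : (groupHomology.inhomogeneousChains M).X q ⟶ ModuleCat.of ℤ N :=
    @ModuleCat.ofHom ℤ _ ((Fin q → G) →₀ M) N _ inst _ _
      (@toIntLinear ((Fin q → G) →₀ M) N _ _ inst _ φ)
  have hφ' : (groupHomology.inhomogeneousChains M).d (q + 1) q ≫ φ' = 0 := by
    rw [groupHomology.inhomogeneousChains.d_def]
    refine ModuleCat.hom_ext (DFunLike.ext _ _ fun y => ?_)
    exact hφ y
  obtain ⟨Φ, hΦ⟩ := exists_complex_homology_desc _ q φ' hφ'
  exact ⟨Φ.hom.toAddMonoidHom, fun z => congrArg (fun f => f.hom z) hΦ⟩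

end Classes

end Comparison

end RingHomology

namespace RingHomology

/-! ### Decomposition of homology classes -/

section Decomposition

open QuotGroup FullCompletion Finsupp

variable {R : Type} [Ring R] {S : Submonoid R} [Module.Finite ℤ R] [hS : IsAdmissible S]
  [Module.Free ℤ R]

theorem exists_mapRange_eq {ι M N : Type} [AddCommGroup M] [AddCommGroup N] (J : M →+ N)
    (hJ : Function.Injective J) (y : ι →₀ N) (hy : ∀ i, ∃ p, J p = y i) :
    ∃ y', mapRange.addMonoidHom J y' = y := by
  choose p hp using hy
  refine ⟨ofSupportFinite p (y.hasFiniteSupport.subset fun i hi h0 => hi ?_), Finsupp.ext hp⟩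
  exact hJ (by rw [hp, h0, map_zero])

/-- Finitely many functions in `ℤ𝒜̄` are invariant under a common `n R̄`. -/
theorem exists_chain_lift {ι : Type} (y : ι →₀ Coeff S) :
    ∃ (n : ℕ) (hn : 0 < n) (y' : ι →₀ ((RatAlg R ⧸ lattice (ofNat n hn : QuotGroup S)) →₀ ℤ)),
      mapRange.addMonoidHom (stepMap (ofNat n hn)) y' = y := by
  choose n hn p hp using fun i => exists_stepMap_eq (y i)
  have hN : 0 < ∏ i ∈ y.support, n i := Finset.prod_pos fun i _ => hn i
  refine ⟨_, hN, exists_mapRange_eq _ (stepMap_injective _) y fun i => ?_⟩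
  by_cases hi : i ∈ y.support
  · obtain ⟨k, hk⟩ := Finset.dvd_prod_of_mem n hi
    have hkpos : 0 < k := Nat.pos_of_ne_zero fun h0 => hN.ne' (by rw [hk, h0, mul_zero])
    have h1 : (ofNat _ hN : QuotGroup S) = ofNat (n i) (hn i) * ofNat k hkpos := by
      rw [← ofNat_mul]
      congr 1
    obtain ⟨p', hp', -⟩ := exists_refine (ofNat (n i) (hn i) : QuotGroup S)
      (posInt S k hkpos).1 (p i)
    rw [h1, ← hp i]
    exact ⟨p', hp'⟩
  · exact ⟨0, by rw [map_zero, notMem_support_iff.1 hi]⟩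

theorem exists_sum_zsmul_of_mem_closure_range {ι M : Type} [Fintype ι] [AddCommGroup M]
    (F : ι → M) {v : M} (hv : v ∈ AddSubgroup.closure (Set.range F)) :
    ∃ c : ι → ℤ, v = ∑ i, c i • F i := by
  rw [← Submodule.span_int_eq_addSubgroupClosure] at hv
  obtain ⟨c, hc⟩ := (Submodule.mem_span_range_iff_exists_fun ℤ).1 hv
  exact ⟨c, hc.symm⟩

/-- The `ℚ`-basis of `𝒜` obtained from a `ℤ`-basis of `R`. -/
noncomputable def ratBasis {d : ℕ} (b : Module.Basis (Fin d) ℤ R) :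
    Module.Basis (Fin d) ℚ (RatAlg R) := b.baseChange ℚ

omit [Module.Finite ℤ R] [Module.Free ℤ R] in
theorem ratBasis_apply {d : ℕ} (b : Module.Basis (Fin d) ℤ R) (i : Fin d) :
    ratBasis b i = 1 ⊗ₜ b i := Module.Basis.baseChange_apply _ _ _

theorem isWedgeSpanned_lattice {d : ℕ} (b : Module.Basis (Fin d) ℤ R) (a : QuotGroup S) :
    IsWedgeSpanned (Rep.of (quotRep (lattice a)))
      (fun i => (embed S a : RatAlg R) * (1 ⊗ₜ b i)) (single 0 1) := by
  have hspan : lattice a =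
      Submodule.span ℤ (Set.range fun i => (embed S a : RatAlg R) * (1 ⊗ₜ b i)) := by
    rw [lattice, LinearMap.range_eq_map, ← b.span_eq, Submodule.map_span, ← Set.range_comp]
    rfl
  have hind : LinearIndependent ℤ fun i => (embed S a : RatAlg R) * (1 ⊗ₜ b i) := by
    have h1 := (ratBasis b).linearIndependent.map' (LinearMap.mulLeft ℚ (embed S a : RatAlg R))
      (LinearMap.ker_eq_bot.2 fun x y h => (embed S a).isUnit.mul_left_cancel h)
    have h2 := h1.restrict_scalars (R := ℤ) (by
      intro m n h
      simpa using h)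
    have h3 : (fun i => (embed S a : RatAlg R) * (1 ⊗ₜ b i)) =
        LinearMap.mulLeft ℚ (embed S a : RatAlg R) ∘ ratBasis b :=
      funext fun i => congrArg _ (ratBasis_apply b i).symm
    rw [h3]
    exact h2
  have h := isWedgeSpanned_quotRep _ hind
  rw [hspan]
  exact h

/-- A cycle whose coefficients come from `ℤ[𝒜 ⧸ a R]` is homologous to a combination of alternating
chains on `a b₁, …, a b_d`. The map `J` is `stepMap a`, typed as a map between the modules
underlying the two representations. -/
theorem cycle_decomposition_of_lift {d : ℕ} (b : Module.Basis (Fin d) ℤ R) (a : QuotGroup S) (q : ℕ)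
    (z : groupHomology.cycles (coeffRep S) q)
    (y : (Fin q → Multiplicative (RatAlg R)) →₀ Rep.of (quotRep (lattice a)))
    (J : Rep.of (quotRep (lattice a)) →+ coeffRep S) (hJa : J = stepMap a)
    (hy : mapRange.addMonoidHom J y = groupHomology.iCycles (coeffRep S) q z) :
    ∃ (c : (Fin q ↪o Fin d) → ℤ) (w : _),
      groupHomology.iCycles (coeffRep S) q z =
        ∑ f, c f • wedgeChain (fun i => Multiplicative.ofAdd
          ((embed S a : RatAlg R) * (1 ⊗ₜ b (f i)))) (dilate a (ballInd S)) +
        chainD (coeffRep S) q w := by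
  have hJ (g : Multiplicative (RatAlg R)) (m : Rep.of (quotRep (lattice a))) :
      J ((Rep.of (quotRep (lattice a))).ρ g m) = (coeffRep S).ρ g (J m) := by
    subst hJa
    exact stepMap_quotRep a g m
  have hJ1 : J (single 0 1) = dilate a (ballInd S) := by
    subst hJa
    have h := stepMap_single a 0 1
    rw [map_zero, one_smul] at h
    refine h.trans ?_
    ext x
    rw [cosetInd, shift_apply, map_zero, sub_zero]
  have hJinj : Function.Injective J := by
    subst hJa
    exact stepMap_injective a
  have hspan := isWedgeSpanned_lattice b a
  have hmem : y ∈ wedgeSpan (Rep.of (quotRep (lattice a)))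
      (fun i => (embed S a : RatAlg R) * (1 ⊗ₜ b i)) (single 0 1) q := by
    cases q with
    | zero => exact hspan.1 y
    | succ q =>
      refine hspan.2 q y ?_
      have hinj : Function.Injective
          (mapRange.addMonoidHom J : ((Fin q → Multiplicative (RatAlg R)) →₀ _) →+ _) :=
        mapRange_injective J (map_zero J) hJinj
      refine hinj ?_
      rw [← chainD_mapRange J hJ, map_zero, hy]
      exact chainD_iCycles q z
  obtain ⟨v, hv, _, ⟨w, rfl⟩, rfl⟩ := AddSubgroup.mem_sup.1 hmem
  obtain ⟨c, rfl⟩ := exists_sum_zsmul_of_mem_closure_range _ hv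
  refine ⟨c, mapRange.addMonoidHom J w, ?_⟩
  rw [← hy, map_add, map_sum, chainD_mapRange J hJ]
  congr 1
  refine Finset.sum_congr rfl fun f _ => ?_
  rw [map_zsmul, mapRange_wedgeChain, hJ1]

/-- Every cycle with coefficients in `ℤ𝒜̄` is homologous to a combination of alternating chains
on the basis `n b₁, …, n b_d` of some lattice `n R`, with coefficient the characteristic function
of `n R̄`. -/
theorem exists_cycle_decomposition {d : ℕ} (b : Module.Basis (Fin d) ℤ R) (q : ℕ)
    (z : groupHomology.cycles (coeffRep S) q) :
    ∃ (n : ℕ) (hn : 0 < n) (c : (Fin q ↪o Fin d) → ℤ) (w : _),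
      groupHomology.iCycles (coeffRep S) q z =
        ∑ f, c f • wedgeChain (fun i => Multiplicative.ofAdd
          ((embed S (ofNat n hn) : RatAlg R) * (1 ⊗ₜ b (f i)))) (dilate (ofNat n hn) (ballInd S)) +
        chainD (coeffRep S) q w := by
  obtain ⟨n, hn, y, hy⟩ := exists_chain_lift
    (S := S) (groupHomology.iCycles (coeffRep S) q z : (Fin q → _) →₀ Coeff S)
  exact ⟨n, hn, cycle_decomposition_of_lift b _ q z y _ rfl hy⟩

omit [Module.Finite ℤ R] [Module.Free ℤ R] in
theorem linearIndependent_wedge {d : ℕ} (b : Module.Basis (Fin d) ℤ R) (q : ℕ) :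
    LinearIndependent ℚ fun f : Fin q ↪o Fin d =>
      exteriorPower.ιMulti ℚ q fun i => (1 ⊗ₜ b (f i) : RatAlg R) := by
  have h := (exteriorPower.ιMulti_family_linearIndependent_ofBasis ℚ q (ratBasis b)).comp
    Set.powersetCard.ofFinEmbEquiv (Equiv.injective _)
  have h1 : (fun f : Fin q ↪o Fin d =>
      exteriorPower.ιMulti ℚ q fun i => (1 ⊗ₜ b (f i) : RatAlg R)) =
      exteriorPower.ιMulti_family ℚ q (ratBasis b) ∘ Set.powersetCard.ofFinEmbEquiv := by
    funext f
    rw [Function.comp_apply, exteriorPower.ιMulti_family, Equiv.symm_apply_apply]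
    exact congrArg _ (funext fun i => (ratBasis_apply b (f i)).symm)
  rw [h1]
  exact h

theorem span_wedge (q : ℕ) :
    Submodule.span ℚ (Set.range fun r : Fin q → R =>
      exteriorPower.ιMulti ℚ q fun i => (1 ⊗ₜ r i : RatAlg R)) = ⊤ := by
  have b := Module.finBasis ℤ R
  rw [eq_top_iff, ← exteriorPower.ιMulti_family_span_of_span ℚ (ratBasis b).span_eq]
  refine Submodule.span_mono ?_
  rintro _ ⟨s, rfl⟩
  refine ⟨fun i => b (Set.powersetCard.ofFinEmbEquiv.symm s i), ?_⟩
  exact congrArg _ (funext fun i => (ratBasis_apply b _).symm)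

theorem extBaseChange_injective (q : ℕ) : Function.Injective (extBaseChange R q) := by
  have b := Module.finBasis ℤ R
  refine (injective_iff_map_eq_zero _).2 fun x hx => ?_
  have hind := ((exteriorPower.ιMulti_family_linearIndependent_ofBasis ℚ q
    (ratBasis b)).restrict_scalars (R := ℤ) (by
      intro m n h
      simpa using h))
  rw [← (b.exteriorPower q).sum_repr x, map_sum] at hx
  have h1 (s) : extBaseChange R q (b.exteriorPower q s) =
      exteriorPower.ιMulti_family ℚ q (ratBasis b) s := by
    rw [exteriorPower.basis_apply, exteriorPower.ιMulti_family, extBaseChange_ιMulti]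
    exact congrArg _ (funext fun i => (ratBasis_apply b _).symm)
  simp only [map_smul, h1] at hx
  have h2 := Fintype.linearIndependent_iff.1 hind _ hx
  rw [← (b.exteriorPower q).sum_repr x]
  exact Finset.sum_eq_zero fun s _ => by rw [h2 s, zero_smul]

end Decomposition

end RingHomology

namespace RingHomology

/-! ### The homology of `𝒜` with coefficients in `ℤ𝒜̄` -/

section Main

open QuotGroup FullCompletion Finsupp

variable {R : Type} [Ring R] {S : Submonoid R} [Module.Finite ℤ R] [hS : IsAdmissible S]
  [Module.Free ℤ R]

variable (S) in
/-- The map `H_q(𝒜, ℤ𝒜̄) → ⋀^q 𝒜` induced by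
`[x₁ | ⋯ | x_q] ⊗ f ↦ (1 / q!) (∫ f) x₁ ∧ ⋯ ∧ x_q`. -/
noncomputable def comparison (q : ℕ) : Homology S q →+ ⋀[ℚ]^q (RatAlg R) :=
  (exists_homology_desc (M := coeffRep S) q (wedgeIntegral S q) (wedgeIntegral_chainD q)).choose

theorem comparison_π (q : ℕ) (z : groupHomology.cycles (coeffRep S) q) :
    comparison S q (groupHomology.π (coeffRep S) q z) =
      wedgeIntegral S q (groupHomology.iCycles (coeffRep S) q z) :=
  (exists_homology_desc (M := coeffRep S) q (wedgeIntegral S q)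
    (wedgeIntegral_chainD q)).choose_spec z

theorem exists_cycle_of_fixed {q : ℕ} (t : Fin q → Multiplicative (RatAlg R)) (u : Coeff S)
    (hu : ∀ i, (coeffRep S).ρ (t i)⁻¹ u = u) :
    ∃ z, groupHomology.iCycles (coeffRep S) q z = wedgeChain t u := by
  cases q with
  | zero => exact exists_cycle_zero (M := coeffRep S) _
  | succ q =>
    exact exists_cycle_succ q _ (chainD_wedgeChain_of_forall_fixed (coeffRep S) t u hu)

theorem translationRep_ballInd (r : R) :
    translationRep S (Multiplicative.ofAdd (1 ⊗ₜ r : RatAlg R))⁻¹ (ballInd S) = ballInd S := by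
  ext x
  refine ballInd_congr (AddSubgroup.add_mem_cancel_right _ (neg_mem ?_))
  exact ofRat_mem_unitBall.2 ⟨-r, (TensorProduct.tmul_neg _ _).symm⟩

/-- The alternating chain on `r₁, …, r_q` with coefficient `1_R̄` is a cycle because `R` fixes
`1_R̄`, and its image is the wedge because `1_R̄` has integral `1`. -/
theorem exists_isWedgeClass {q : ℕ} (r : Fin q → R) :
    ∃ c : Homology S q, IsWedgeClass r c ∧
      comparison S q c = exteriorPower.ιMulti ℚ q fun i => (1 ⊗ₜ r i : RatAlg R) := by
  obtain ⟨z, hz⟩ := exists_cycle_of_fixed (fun i => Multiplicative.ofAdd (1 ⊗ₜ r i : RatAlg R))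
    (ballInd S) fun i => translationRep_ballInd (r i)
  refine ⟨groupHomology.π (coeffRep S) q z, ⟨ballInd S, z, fun x hx => ballInd_of_mem ?_,
    fun x hx => ballInd_of_notMem ?_, ?_, rfl⟩, ?_⟩
  · exact hx
  · exact hx
  · rw [hz]
    exact wedgeChain_apply _ _
  · rw [comparison_π, hz]
    refine (wedgeIntegral_wedgeChain _ _).trans ?_
    rw [integralHom_ballInd, one_smul]

theorem wedgeIntegral_chainsMap (a : QuotGroup S) (q : ℕ)
    (y : (Fin q → Multiplicative (RatAlg R)) →₀ Coeff S) :
    wedgeIntegral S q ((groupHomology.chainsMap (mulHom a) (coeffMap a)).f q y) =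
      |ratNorm a|⁻¹ • extMul a q (wedgeIntegral S q y) := by
  induction y using Finsupp.induction_linear with
  | zero =>
    refine (congrArg (wedgeIntegral S q) (map_zero _)).trans ?_
    rw [map_zero, map_zero, smul_zero]
  | add y y' h h' =>
    refine (congrArg (wedgeIntegral S q) (map_add _ y y')).trans ?_
    refine (map_add _ _ _).trans ?_
    rw [map_add, map_add, smul_add, ← h, ← h']
  | single g f =>
    have h1 := groupHomology.chainsMap_f_single (mulHom a) (coeffMap a) q g f
    refine (congrArg (wedgeIntegral S q) h1).trans ?_
    refine (wedgeIntegral_single q _ (dilate a f)).trans ?_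
    rw [integralHom_dilate, wedgeIntegral_single, map_smul, map_smul, mul_smul, extMul,
      exteriorPower.map_apply_ιMulti]
    rfl

theorem comparison_theta (a : QuotGroup S) (q : ℕ) (c : Homology S q) :
    comparison S q (theta a q c) = |ratNorm a|⁻¹ • extMul a q (comparison S q c) := by
  induction c using groupHomology_induction_on with
  | h z =>
    have h1 := groupHomology.π_map_apply (mulHom a) (coeffMap a) q z
    have h2 := HomologicalComplex.cyclesMap_i (groupHomology.chainsMap (mulHom a) (coeffMap a)) q
    have h3 := congrArg (fun f => f.hom z) h2
    refine (congrArg (comparison S q) h1).trans ?_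
    refine (comparison_π q _).trans ?_
    rw [comparison_π, ← wedgeIntegral_chainsMap]
    exact congrArg (wedgeIntegral S q) h3

/-- The factor `n ^ q` comes from the homogeneity of the wedge, the factor `n ^ (-d)` is the volume
of `n R̄`. -/
theorem wedgeIntegral_lattice {q : ℕ} (n : ℕ) (hn : 0 < n) (r : Fin q → R) :
    wedgeIntegral S q (wedgeChain (fun i => Multiplicative.ofAdd
      ((embed S (ofNat n hn) : RatAlg R) * (1 ⊗ₜ r i))) (dilate (ofNat n hn) (ballInd S))) =
      ((n : ℚ) ^ q * ((n : ℚ) ^ Module.finrank ℤ R)⁻¹) •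
        exteriorPower.ιMulti ℚ q fun i => (1 ⊗ₜ r i : RatAlg R) := by
  have h1 : (fun i => (embed S (ofNat n hn) : RatAlg R) * (1 ⊗ₜ r i)) =
      fun i => (n : ℚ) • (1 ⊗ₜ r i : RatAlg R) := by
    funext i
    rw [coe_embed_ofNat, Nat.cast_smul_eq_nsmul, nsmul_eq_mul]
  have h2 := (exteriorPower.ιMulti ℚ q (M := RatAlg R)).map_smul_univ (fun _ => (n : ℚ))
    fun i => (1 ⊗ₜ r i : RatAlg R)
  rw [wedgeIntegral_wedgeChain, h1, integralHom_dilate, integralHom_ballInd, ratNorm_ofNat,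
    abs_of_nonneg (by positivity), h2, smul_smul, Finset.prod_const, Finset.card_univ,
    Fintype.card_fin, mul_one, mul_comm]

/-- The coefficients `k` of a class in terms of alternating classes on a lattice `n R` determine
both its image under `comparison` and the class itself; in particular the class vanishes with
them. -/
theorem comparison_decomposition {d : ℕ} (b : Module.Basis (Fin d) ℤ R) (q : ℕ)
    (c : Homology S q) :
    ∃ (n : ℕ) (_ : 0 < n) (k : (Fin q ↪o Fin d) → ℤ),
      comparison S q c = ((n : ℚ) ^ q * ((n : ℚ) ^ d)⁻¹) • ∑ f, k f •
        exteriorPower.ιMulti ℚ q (fun i => (1 ⊗ₜ b (f i) : RatAlg R)) ∧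
      (k = 0 → c = 0) := by
  induction c using groupHomology_induction_on with
  | h z =>
    obtain ⟨n, hn, k, w, h⟩ := exists_cycle_decomposition b q z
    refine ⟨n, hn, k, ?_, fun hk => ?_⟩
    · rw [comparison_π, h, map_add, wedgeIntegral_chainD, add_zero, map_sum, Finset.smul_sum]
      refine Finset.sum_congr rfl fun f _ => ?_
      rw [map_zsmul, wedgeIntegral_lattice, smul_comm, Module.finrank_eq_card_basis b,
        Fintype.card_fin]
    · refine homologyπ_eq_zero_of_eq_chainD q z w ?_
      rw [h, hk]
      simp

theorem comparison_injective (q : ℕ) : Function.Injective (comparison S q) := by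
  have b := Module.finBasis ℤ R
  refine (injective_iff_map_eq_zero _).2 fun c hc => ?_
  obtain ⟨n, hn, k, h1, h2⟩ := comparison_decomposition b q c
  refine h2 (funext fun f => ?_)
  rw [hc, eq_comm, smul_eq_zero_iff_right (by positivity)] at h1
  simp only [← Int.cast_smul_eq_zsmul ℚ] at h1
  exact_mod_cast Fintype.linearIndependent_iff.1 (linearIndependent_wedge b q) _ h1 f

/-- Below the top degree the image is divisible, because `θ_n` is multiplication by
`n ^ (q - d)`. -/
theorem comparison_surjective {q : ℕ} (hq : q < Module.finrank ℤ R) :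
    Function.Surjective (comparison S q) := by
  have hdiv (n : ℕ) (hn : 0 < n) (x : ⋀[ℚ]^q (RatAlg R)) (hx : x ∈ (comparison S q).range) :
      (n : ℚ)⁻¹ • x ∈ (comparison S q).range := by
    obtain ⟨c, rfl⟩ := hx
    refine ⟨n ^ (Module.finrank ℤ R - q - 1) • theta (ofNat n hn) q c, ?_⟩
    have hext : extMul (ofNat n hn : QuotGroup S) q = (n : ℚ) ^ q • LinearMap.id := by
      refine exteriorPower.linearMap_ext (AlternatingMap.ext fun v => ?_)
      have h2 := (exteriorPower.ιMulti ℚ q (M := RatAlg R)).map_smul_univ (fun _ => (n : ℚ)) v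
      rw [Finset.prod_const, Finset.card_univ, Fintype.card_fin] at h2
      refine Eq.trans ?_ h2
      refine (exteriorPower.map_apply_ιMulti _ _).trans (congrArg _ (funext fun i => ?_))
      rw [Function.comp_apply, LinearMap.mulLeft_apply, coe_embed_ofNat,
        Nat.cast_smul_eq_nsmul, nsmul_eq_mul]
    have hn' : (n : ℚ) ≠ 0 := by positivity
    rw [map_nsmul, comparison_theta, hext, ratNorm_ofNat, abs_of_nonneg (by positivity),
      ← Nat.cast_smul_eq_nsmul ℚ, LinearMap.smul_apply, LinearMap.id_apply, smul_smul, smul_smul]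
    congr 1
    obtain ⟨m, hm⟩ := Nat.exists_eq_add_of_lt hq
    rw [hm, show q + m + 1 - q - 1 = m by omega]
    push_cast
    field_simp
    ring
  let V : Submodule ℚ (⋀[ℚ]^q (RatAlg R)) :=
    { (comparison S q).range with
      smul_mem' := fun a x hx => by
        have h : a • x = a.num • ((a.den : ℚ)⁻¹ • x) := by
          rw [← Int.cast_smul_eq_zsmul ℚ, smul_smul, ← div_eq_mul_inv, Rat.num_div_den]
        rw [h]
        exact (comparison S q).range.zsmul_mem (hdiv _ a.pos x hx) _ }
  have hV : V = ⊤ := by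
    rw [eq_top_iff, ← span_wedge, Submodule.span_le]
    rintro _ ⟨r, rfl⟩
    obtain ⟨c, -, hc⟩ := exists_isWedgeClass (S := S) r
    exact ⟨c, hc⟩
  intro x
  have hx : x ∈ V := hV ▸ Submodule.mem_top
  exact hx

/-- In the top degree the factors `n ^ q` and `n ^ (-d)` cancel, so the image is `⋀^d R`. -/
theorem range_comparison_finrank :
    (comparison S (Module.finrank ℤ R)).range =
      (extBaseChange R (Module.finrank ℤ R)).toAddMonoidHom.range := by
  have b := Module.finBasis ℤ R
  apply le_antisymm
  · rintro _ ⟨c, rfl⟩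
    obtain ⟨n, hn, k, h, -⟩ := comparison_decomposition b _ c
    refine ⟨∑ f, k f • exteriorPower.ιMulti ℤ _ (fun i => b (f i)), ?_⟩
    rw [h, mul_inv_cancel₀ (by positivity), one_smul, map_sum]
    refine Finset.sum_congr rfl fun f _ => ?_
    rw [map_zsmul]
    exact congrArg _ (extBaseChange_ιMulti _)
  · rintro _ ⟨x, rfl⟩
    have hx : x ∈ Submodule.span ℤ (Set.range (exteriorPower.ιMulti ℤ (Module.finrank ℤ R)
      (M := R))) := by
      rw [exteriorPower.ιMulti_span]
      trivial
    induction hx using Submodule.span_induction with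
    | mem x hx =>
      obtain ⟨r, rfl⟩ := hx
      obtain ⟨c, -, hc⟩ := exists_isWedgeClass (S := S) r
      exact ⟨c, hc.trans (extBaseChange_ιMulti r).symm⟩
    | zero => exact ⟨0, by rw [map_zero, map_zero]⟩
    | add x y _ _ hx hy =>
      rw [map_add]
      exact add_mem hx hy
    | smul n x _ hx =>
      rw [map_zsmul]
      exact AddSubgroup.zsmul_mem _ hx n

variable (S) in
/-- The isomorphism `H_q(𝒜, ℤ𝒜̄) ≅ ⋀^q 𝒜` below the top degree. -/
noncomputable def homologyEquiv {q : ℕ} (hq : q < Module.finrank ℤ R) :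
    Homology S q ≃+ ⋀[ℚ]^q (RatAlg R) :=
  AddEquiv.ofBijective (comparison S q) ⟨comparison_injective q, comparison_surjective hq⟩

theorem exists_homologyEquiv_top :
    ∃ e : Homology S (Module.finrank ℤ R) ≃+ ⋀[ℤ]^(Module.finrank ℤ R) R,
      ∀ c, extBaseChange R _ (e c) = comparison S _ c := by
  let e₁ := AddMonoidHom.ofInjective (comparison_injective (S := S) (Module.finrank ℤ R))
  let e₂ := AddMonoidHom.ofInjective (f := (extBaseChange R (Module.finrank ℤ R)).toAddMonoidHom)
    (extBaseChange_injective _)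
  let e₃ := AddEquiv.addSubgroupCongr (range_comparison_finrank (S := S))
  refine ⟨(e₁.trans e₃).trans e₂.symm, fun c => ?_⟩
  have h : e₂ (e₂.symm (e₃ (e₁ c))) = e₃ (e₁ c) := e₂.apply_symm_apply _
  exact congrArg Subtype.val h

/-- Above the top degree there are no strictly increasing `q`-tuples of indices, so no alternating
classes. -/
theorem subsingleton_homology {q : ℕ} (hq : Module.finrank ℤ R < q) :
    Subsingleton (Homology S q) := by
  have b := Module.finBasis ℤ R
  have hempty : IsEmpty (Fin q ↪o Fin (Module.finrank ℤ R)) := ⟨fun f => by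
    have := Fintype.card_le_of_injective f f.injective
    simp only [Fintype.card_fin] at this
    omega⟩
  refine subsingleton_of_forall_eq 0 fun c => ?_
  obtain ⟨n, hn, k, -, h⟩ := comparison_decomposition b q c
  exact h (Subsingleton.elim _ _)

end Main

end RingHomology

theorem mainTheorem10 (R : Type) [Ring R] [Module.Free ℤ R] [Module.Finite ℤ R]
    (d : ℕ) (hd : 0 < d) (hrank : Module.finrank ℤ R = d)
    (S : Submonoid R) [RingHomology.IsAdmissible S] :
    (∀ q : ℕ, q < d → ∃ e : RingHomology.Homology S q ≃+ ⋀[ℚ]^q (RingHomology.RatAlg R),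
      (∀ r : Fin q → R, RingHomology.IsWedgeClass r
        (e.symm (exteriorPower.ιMulti ℚ q (fun i => (1 ⊗ₜ r i : RingHomology.RatAlg R))))) ∧
      (∀ (a : RingHomology.QuotGroup S) (c : RingHomology.Homology S q),
        e (RingHomology.theta a q c) =
          |RingHomology.ratNorm a|⁻¹ • RingHomology.extMul a q (e c))) ∧
    (∃ e : RingHomology.Homology S d ≃+ ⋀[ℤ]^d R,
      (∀ r : Fin d → R, RingHomology.IsWedgeClass r (e.symm (exteriorPower.ιMulti ℤ d r))) ∧
      (∀ (a : RingHomology.QuotGroup S) (c : RingHomology.Homology S d),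
        RingHomology.extBaseChange R d (e (RingHomology.theta a d c)) =
          |RingHomology.ratNorm a|⁻¹ •
            RingHomology.extMul a d (RingHomology.extBaseChange R d (e c)))) ∧
    Function.Injective (RingHomology.extBaseChange R d) ∧
    Nonempty (⋀[ℤ]^d R ≃+ ℤ) ∧
    (∀ q : ℕ, d < q → Subsingleton (RingHomology.Homology S q)) := by
  subst hrank
  refine ⟨fun q hq => ⟨RingHomology.homologyEquiv S hq, fun r => ?_, fun a c =>
    RingHomology.comparison_theta a q c⟩, ?_, RingHomology.extBaseChange_injective _, ?_,
    fun q hq => RingHomology.subsingleton_homology hq⟩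
  · obtain ⟨c, hc, h⟩ := RingHomology.exists_isWedgeClass (S := S) r
    rw [← h]
    exact ((RingHomology.homologyEquiv S hq).symm_apply_apply c).symm ▸ hc
  · obtain ⟨e, he⟩ := RingHomology.exists_homologyEquiv_top (S := S)
    refine ⟨e, fun r => ?_, fun a c => by
      rw [he, he, RingHomology.comparison_theta]⟩
    obtain ⟨c, hc, h⟩ := RingHomology.exists_isWedgeClass (S := S) r
    have h1 : exteriorPower.ιMulti ℤ _ r = e c := RingHomology.extBaseChange_injective _ (by
      rw [he, h, RingHomology.extBaseChange_ιMulti])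
    rw [h1, e.symm_apply_apply]
    exact hc
  · refine ⟨(LinearEquiv.ofFinrankEq (R := ℤ) (⋀[ℤ]^(Module.finrank ℤ R) R) ℤ ?_).toAddEquiv⟩
    rw [exteriorPower.finrank_eq, Nat.choose_self, Module.finrank_self]
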